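/- Let $E=(E^0,E^1,r,s)$ be an arbitrary directed graph and let $R$ be a commutative ring with unit. Let $L_R(E)$ be the Leavitt path algebra, i.e. the universal (not necessarily unital) associative $R$-algebra generated by pairwise orthogonal idempotents $v$ ($v\in E^0$) and elements $e,e^*$ ($e\in E^1$) subject to $s(e)e=e=e\,r(e)$ and $r(e)e^*=e^*=e^*s(e)$ for all $e\in E^1$; $e^*e=r(e)$ and $e^*f=0$ for $e\ne f$ in $E^1$; and $v=\sum_{s(e)=v}ee^*$ for every vertex $v$ with $s^{-1}(v)$ finite and non-empty. It carries the $R$-linear involution $x\mapsto x^*$ with $v\mapsto v$, $e\mapsto e^*$, $e^*\mapsto e$. A finite path $\alpha=e_1\cdots e_n$ (or a vertex, as a path of length $0$) is regarded as an element of $L_R(E)$. Let $\Delta(E)$ be the (not necessarily unital) $R$-subalgebra of $L_R(E)$ generated by all $\alpha\alpha^*$, with $\alpha$ a finite path, and let the commutative core $M_R(E)$ be the (not necessarily unital) $R$-subalgebra generated by all those elements $x=\alpha\beta^*$, with $\alpha,\beta$ finite paths and $r(\alpha)=r(\beta)$, that are normal, i.e. $xx^*=x^*x$. Then $$M_R(E)=\{x\in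 L_R(E): xd=dx\text{ for every } d\in\Delta(E)\}.$$ Furthermore, $M_R(E)$ is a maximal commutative $*$-subalgebra of $L_R(E)$: it is closed under the involution, it is commutative, and every commutative $R$-subalgebra $C$ of $L_R(E)$ with $M_R(E)\subseteq C$ equals $M_R(E)$. -/

import Mathlib

universe t w u

/-! A directed graph `E = (E⁰, E¹, r, s)` is a quiver on the type `V = E⁰`. Its set of edges `E¹` is
`Quiver.Total V`, with source map `Quiver.Total.left` and range map `Quiver.Total.right`, and
`Quiver.Path a b` is the type of finite paths with source `a` and range `b` (the path of length `0`
at `a` is `Quiver.Path.nil`). -/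

namespace LeavittPath

/-- The generators: vertices `v`, edges `e` and ghost edges `e*`. -/
inductive Gen (V : Type u) [Quiver.{w} V] : Type max u w
  | vertex (v : V) : Gen V
  | edge (e : Quiver.Total V) : Gen V
  | ghost (e : Quiver.Total V) : Gen V

/-- The free associative (non-unital) `R`-algebra on the generators. -/
abbrev FreeAlg (R : Type t) [CommRing R] (V : Type u) [Quiver.{w} V] : Type _ :=
  MonoidAlgebra R (FreeSemigroup (Gen V))

/-- A generator as an element of the free algebra. -/
noncomputable def gen (R : Type t) [CommRing R] {V : Type u} [Quiver.{w} V] (g : Gen V) :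
    FreeAlg R V :=
  MonoidAlgebra.single (FreeSemigroup.of g) 1

open Gen in
/-- The defining relations of the Leavitt path algebra. -/
inductive Rel (R : Type t) [CommRing R] (V : Type u) [Quiver.{w} V] :
    FreeAlg R V → FreeAlg R V → Prop
  | vertex_idem (v : V) : Rel R V (gen R (vertex v) * gen R (vertex v)) (gen R (vertex v))
  | vertex_orth (v v' : V) (h : v ≠ v') : Rel R V (gen R (vertex v) * gen R (vertex v')) 0
  | source_edge (e : Quiver.Total V) :
      Rel R V (gen R (vertex e.left) * gen R (edge e)) (gen R (edge e))
  | edge_range (e : Quiver.Total V) :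
      Rel R V (gen R (edge e) * gen R (vertex e.right)) (gen R (edge e))
  | range_ghost (e : Quiver.Total V) :
      Rel R V (gen R (vertex e.right) * gen R (ghost e)) (gen R (ghost e))
  | ghost_source (e : Quiver.Total V) :
      Rel R V (gen R (ghost e) * gen R (vertex e.left)) (gen R (ghost e))
  | ck1_same (e : Quiver.Total V) :
      Rel R V (gen R (ghost e) * gen R (edge e)) (gen R (vertex e.right))
  | ck1_ne (e f : Quiver.Total V) (h : e ≠ f) : Rel R V (gen R (ghost e) * gen R (edge f)) 0
  | ck2 (v : V) (hfin : {e : Quiver.Total V | e.left = v}.Finite)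
      (hne : {e : Quiver.Total V | e.left = v}.Nonempty) :
      Rel R V (gen R (vertex v)) (∑ e ∈ hfin.toFinset, gen R (edge e) * gen R (ghost e))

/-- The smallest congruence of `R`-algebras containing the defining relations. (Closing the
relations under scalars first makes the generated ring congruence compatible with scalars.) -/
noncomputable def con (R : Type t) [CommRing R] (V : Type u) [Quiver.{w} V] : RingCon (FreeAlg R V) :=
  ringConGen fun x y => ∃ (c : R) (x' y' : FreeAlg R V), Rel R V x' y' ∧ x = c • x' ∧ y = c • y'

theorem con_smul {R : Type t} [CommRing R] {V : Type u} [Quiver.{w} V] (c : R)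
    {x y : FreeAlg R V} (h : con R V x y) : con R V (c • x) (c • y) := by
  change RingConGen.Rel _ x y at h
  induction h with
  | of x y h =>
    obtain ⟨d, x', y', h, rfl, rfl⟩ := h
    exact RingConGen.Rel.of _ _ ⟨c * d, x', y', h, by rw [mul_smul], by rw [mul_smul]⟩
  | refl x => exact (con R V).refl _
  | symm _ ih => exact (con R V).symm ih
  | trans _ _ ih₁ ih₂ => exact (con R V).trans ih₁ ih₂
  | add _ _ ih₁ ih₂ => simpa only [smul_add] using (con R V).add ih₁ ih₂
  | mul _ h₂ ih₁ _ =>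
    simpa only [smul_mul_assoc] using (con R V).mul ih₁ h₂

end LeavittPath

open LeavittPath

/-- The Leavitt path algebra `L_R(E)` (in general without a unit): the universal `R`-algebra on
vertices, edges and ghost edges subject to the defining relations. -/
def LeavittPathAlgebra (R : Type t) [CommRing R] (V : Type u) [Quiver.{w} V] : Type _ :=
  (con R V).Quotient

namespace LeavittPathAlgebra

section

variable {R : Type t} [CommRing R] {V : Type u} [Quiver.{w} V]

noncomputable instance : NonUnitalRing (LeavittPathAlgebra R V) :=
  inferInstanceAs (NonUnitalRing (con R V).Quotient)

/-- The quotient map. -/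
noncomputable def mk (x : FreeAlg R V) : LeavittPathAlgebra R V := (x : (con R V).Quotient)

theorem mk_surjective : Function.Surjective (mk : FreeAlg R V → LeavittPathAlgebra R V) :=
  Quotient.mk_surjective

theorem mk_eq {x y : FreeAlg R V} : mk x = mk y ↔ con R V x y := (con R V).eq

theorem mk_add (x y : FreeAlg R V) : mk (x + y) = mk x + mk y := rfl

theorem mk_mul (x y : FreeAlg R V) : mk (x * y) = mk x * mk y := rfl

noncomputable instance : SMul R (LeavittPathAlgebra R V) where
  smul c := Quotient.map (c • ·) fun _ _ h => con_smul c h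

theorem mk_smul (c : R) (x : FreeAlg R V) : mk (c • x) = c • mk x := rfl

noncomputable instance : Module R (LeavittPathAlgebra R V) :=
  Function.Surjective.module R
    ({ toFun := mk, map_zero' := rfl, map_add' := mk_add } :
      FreeAlg R V →+ LeavittPathAlgebra R V) mk_surjective mk_smul

instance : IsScalarTower R (LeavittPathAlgebra R V) (LeavittPathAlgebra R V) where
  smul_assoc c x y := by
    obtain ⟨x, rfl⟩ := mk_surjective x
    obtain ⟨y, rfl⟩ := mk_surjective y
    simp only [smul_eq_mul, ← mk_smul, ← mk_mul, smul_mul_assoc]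

instance : SMulCommClass R (LeavittPathAlgebra R V) (LeavittPathAlgebra R V) where
  smul_comm c x y := by
    obtain ⟨x, rfl⟩ := mk_surjective x
    obtain ⟨y, rfl⟩ := mk_surjective y
    simp only [smul_eq_mul, ← mk_smul, ← mk_mul, mul_smul_comm]

theorem mk_eq_of_rel {x y : FreeAlg R V} (h : Rel R V x y) : mk x = mk y :=
  mk_eq.2 (RingConGen.Rel.of _ _ ⟨1, x, y, h, (one_smul _ _).symm, (one_smul _ _).symm⟩)

/-- The quotient map as a homomorphism of algebras. -/
noncomputable def mkHom : FreeAlg R V →ₙₐ[R] LeavittPathAlgebra R V where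
  toFun := mk
  map_smul' := mk_smul
  map_zero' := rfl
  map_add' := mk_add
  map_mul' := mk_mul

section lift

variable {A : Type*} [NonUnitalRing A] [Module R A] [IsScalarTower R A A] [SMulCommClass R A A]

/-- The homomorphism from the free algebra determined by the images of the generators. -/
noncomputable def freeLift (f : Gen V → A) : FreeAlg R V →ₙₐ[R] A :=
  MonoidAlgebra.liftMagma R (FreeSemigroup.lift f)

theorem freeLift_gen (f : Gen V → A) (g : Gen V) : freeLift f (gen R g) = f g := by
  simp [freeLift, gen]

/-- Two homomorphisms that agree on the generators are equal. -/
theorem hom_ext {φ ψ : LeavittPathAlgebra R V →ₙₐ[R] A}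
    (h : ∀ g, φ (mk (gen R g)) = ψ (mk (gen R g))) : φ = ψ := by
  have key : φ.comp mkHom = ψ.comp mkHom := by
    apply (MonoidAlgebra.liftMagma R).symm.injective
    apply FreeSemigroup.hom_ext
    funext g
    exact h g
  apply NonUnitalAlgHom.ext
  intro x
  obtain ⟨x, rfl⟩ := mk_surjective x
  exact DFunLike.congr_fun key x

/-- The universal property: the homomorphism determined by images of the generators that satisfy
the defining relations. -/
noncomputable def lift (f : Gen V → A)
    (hf : ∀ x y, Rel R V x y → freeLift (R := R) f x = freeLift f y) :
    LeavittPathAlgebra R V →ₙₐ[R] A where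
  toFun := Quotient.lift (freeLift f) fun x y h => by
    change RingConGen.Rel _ x y at h
    induction h with
    | of x y h =>
      obtain ⟨d, x', y', h, rfl, rfl⟩ := h
      rw [map_smul, map_smul, hf _ _ h]
    | refl x => rfl
    | symm _ ih => exact ih.symm
    | trans _ _ ih₁ ih₂ => exact ih₁.trans ih₂
    | add _ _ ih₁ ih₂ => rw [map_add, map_add, ih₁, ih₂]
    | mul _ _ ih₁ ih₂ => rw [map_mul, map_mul, ih₁, ih₂]
  map_smul' c x := by
    obtain ⟨x, rfl⟩ := mk_surjective x
    exact map_smul (freeLift f) c x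
  map_zero' := map_zero (freeLift (R := R) f)
  map_add' x y := by
    obtain ⟨x, rfl⟩ := mk_surjective x
    obtain ⟨y, rfl⟩ := mk_surjective y
    exact map_add (freeLift f) x y
  map_mul' x y := by
    obtain ⟨x, rfl⟩ := mk_surjective x
    obtain ⟨y, rfl⟩ := mk_surjective y
    exact map_mul (freeLift f) x y

theorem lift_gen (f : Gen V → A)
    (hf : ∀ x y, Rel R V x y → freeLift (R := R) f x = freeLift f y) (g : Gen V) :
    lift f hf (mk (gen R g)) = f g :=
  freeLift_gen f g

end lift

/-- The exchange of edges and ghost edges. -/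
def genStar : Gen V → Gen V
  | .vertex v => .vertex v
  | .edge e => .ghost e
  | .ghost e => .edge e

open MulOpposite in
/-- The involution as a homomorphism to the opposite algebra. -/
noncomputable def starHom : LeavittPathAlgebra R V →ₙₐ[R] (LeavittPathAlgebra R V)ᵐᵒᵖ :=
  lift (fun g => op (mk (gen R (genStar g)))) fun x y h => by
    cases h with
    | ck2 v hfin hne =>
      rw [map_sum]
      simp only [map_mul, freeLift_gen, genStar, ← op_mul, ← mk_mul, ← Finset.op_sum]
      exact congrArg op ((mk_eq_of_rel (Rel.ck2 v hfin hne)).trans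
        (map_sum (mkHom (R := R) (V := V)) _ _))
    | vertex_idem v =>
      simp only [map_mul, freeLift_gen, genStar]
      exact congrArg op (mk_eq_of_rel (Rel.vertex_idem (R := R) v))
    | vertex_orth v v' h =>
      simp only [map_mul, map_zero, freeLift_gen, genStar]
      exact congrArg op (mk_eq_of_rel (Rel.vertex_orth (R := R) v' v h.symm))
    | source_edge e =>
      simp only [map_mul, freeLift_gen, genStar]
      exact congrArg op (mk_eq_of_rel (Rel.ghost_source (R := R) e))
    | edge_range e =>
      simp only [map_mul, freeLift_gen, genStar]
      exact congrArg op (mk_eq_of_rel (Rel.range_ghost (R := R) e))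
    | range_ghost e =>
      simp only [map_mul, freeLift_gen, genStar]
      exact congrArg op (mk_eq_of_rel (Rel.edge_range (R := R) e))
    | ghost_source e =>
      simp only [map_mul, freeLift_gen, genStar]
      exact congrArg op (mk_eq_of_rel (Rel.source_edge (R := R) e))
    | ck1_same e =>
      simp only [map_mul, freeLift_gen, genStar]
      exact congrArg op (mk_eq_of_rel (Rel.ck1_same (R := R) e))
    | ck1_ne e f h =>
      simp only [map_mul, map_zero, freeLift_gen, genStar]
      exact congrArg op (mk_eq_of_rel (Rel.ck1_ne (R := R) f e h.symm))

theorem starHom_gen (g : Gen V) :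
    starHom (mk (gen R g)) = MulOpposite.op (mk (gen R (genStar g))) :=
  lift_gen _ _ g

/-- Applying the involution twice, as a homomorphism. -/
noncomputable def starStarHom : LeavittPathAlgebra R V →ₙₐ[R] LeavittPathAlgebra R V where
  toFun x := (starHom (starHom x).unop).unop
  map_smul' c x := by simp
  map_zero' := by simp
  map_add' x y := by simp
  map_mul' x y := by simp

theorem starStarHom_eq : (starStarHom : LeavittPathAlgebra R V →ₙₐ[R] _) =
    NonUnitalAlgHom.id R (LeavittPathAlgebra R V) := by
  apply hom_ext
  intro g
  change (starHom (starHom (mk (gen R g))).unop).unop = mk (gen R g)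
  rw [starHom_gen, MulOpposite.unop_op, starHom_gen]
  cases g <;> rfl

/-- The `R`-linear involution with `v* = v` and with `e ↦ e*`, `e* ↦ e`. -/
noncomputable instance : StarRing (LeavittPathAlgebra R V) where
  star x := (starHom x).unop
  star_involutive x := DFunLike.congr_fun starStarHom_eq x
  star_mul x y := by simp
  star_add x y := by simp

theorem star_smul' (c : R) (x : LeavittPathAlgebra R V) : star (c • x) = c • star x :=
  congrArg MulOpposite.unop (map_smul starHom c x)

theorem star_gen (g : Gen V) :
    star (mk (gen R g)) = (mk (gen R (genStar g)) : LeavittPathAlgebra R V) :=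
  congrArg MulOpposite.unop (starHom_gen g)

end

section

variable (R : Type t) [CommRing R] {V : Type u} [Quiver.{w} V]

/-- The vertex `v` as an element of the Leavitt path algebra. -/
noncomputable def vertex (v : V) : LeavittPathAlgebra R V := mk (gen R (Gen.vertex v))

/-- The edge `e` as an element of the Leavitt path algebra. -/
noncomputable def edge (e : Quiver.Total V) : LeavittPathAlgebra R V := mk (gen R (Gen.edge e))

/-- The path `e₁ ⋯ eₙ` as an element of the Leavitt path algebra; a path of length `0` is its
vertex. -/
noncomputable def path {a : V} : {b : V} → Quiver.Path a b → LeavittPathAlgebra R V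
  | _, Quiver.Path.nil => vertex R a
  | _, Quiver.Path.cons p e => path p * edge R ⟨_, _, e⟩

variable (V)

/-- The generators `α β*`, for paths `α` and `β` with the same range. -/
noncomputable def generators : Set (LeavittPathAlgebra R V) :=
  {x | ∃ (a b c : V) (α : Quiver.Path a c) (β : Quiver.Path b c), x = path R α * star (path R β)}

/-- The diagonal generators `α α*`. -/
noncomputable def diagonalGenerators : Set (LeavittPathAlgebra R V) :=
  {x | ∃ (a c : V) (α : Quiver.Path a c), x = path R α * star (path R α)}

/-- The diagonal algebra `Δ(E)`: the (non-unital) subalgebra generated by the `α α*`. -/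
noncomputable def diagonal : NonUnitalSubalgebra R (LeavittPathAlgebra R V) :=
  NonUnitalAlgebra.adjoin R (diagonalGenerators R V)

/-- The commutative core `M_R(E)`: the (non-unital) subalgebra generated by those generators
`α β*` that are normal elements of the Leavitt path algebra, that is, `x* x = x x*`. -/
noncomputable def commutativeCore : NonUnitalSubalgebra R (LeavittPathAlgebra R V) :=
  NonUnitalAlgebra.adjoin R {x | x ∈ generators R V ∧ IsStarNormal x}

end

end LeavittPathAlgebra

/-! Any product `α* β` of paths is zero, a path, or the adjoint of a path. Hence the elements `α β*`
span, and the projections `α α*` are nested or orthogonal. Over a nontrivial ring paths are nonzero,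
by a representation on functions.

Commutativity of `M_R(E)`. If `α β*` is normal then `α α* = β β*`, so `α` and `β` are comparable,
and `α β*` or its adjoint is `β η β*` with `η` closed at a vertex `a` and `η η* = a`
(`exists_conj_path_of_isStarNormal`). When `η` has positive length nothing starting at `a` has an
exit, so a path from `a` is determined by its length; this rigidity makes such elements commute with
the diagonal and with each other (`conj_path_commute`). The adjoint of `β η β*` is its inverse in
the corner at `β β*`, so adjoints commute as well. Since each `α α*` is normal, `Δ(E) ⊆ M_R(E)`, and
`M_R(E)` centralizes `Δ(E)`.

The converse. Let `x` commute with `Δ(E)` and be a combination of elements `α γ*` with `γ` of length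
at most `N`. If `β` has length at least `N` and range `a`, then `z = β* x β` combines closed paths
at `a` and their adjoints, and `x β β* = β z β*`. If no closed path at `a` has an exit, `β z β*`
lies in `M_R(E)` term by term; otherwise compression by a suitable path forces `z` to be a multiple
of `a` (`exists_eq_smul_vertex`). For shorter `β`, one splits `β β*` into finitely many one-edge
extensions and a remainder on which `x` acts by a scalar, and inducts on the missing length. This
treats sinks, finite emitters and infinite emitters alike. Finally `x` is a finite sum of elements
`x v`.

Maximality is then formal: a commutative algebra containing `M_R(E)` centralizes `Δ(E)`. -/

namespace LeavittPathAlgebra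

/-! ### A representation in which no vertex has torsion -/

section Representation

open Cardinal in
/-- A family of injections indexed by the edges whose ranges, for the edges leaving a given vertex,
form a partition of the whole set. -/
theorem exists_branching (V : Type u) [Quiver.{w} V] :
    ∃ (K : Type max u w) (_ : Nonempty K) (ψ : Quiver.Total V → K → K),
      (∀ e f k l, e.left = f.left → ψ e k = ψ f l → e = f ∧ k = l) ∧
      ∀ v : V, {e : Quiver.Total V | e.left = v}.Nonempty →
        ∀ k, ∃ e l, e.left = v ∧ ψ e l = k := by
  -- `K` is infinite and at least as large as the set of edges, so `K` is in bijection with (edges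
  -- leaving `v`) × `K` for every `v` that emits an edge; `ψ e` is the slice of that bijection at
  -- `e`.
  let K : Type max u w := ℕ ⊕ Quiver.Total V
  have hK : ℵ₀ ≤ #K := Cardinal.aleph0_le_mk K
  have equiv (v : V) (h : Nonempty {e : Quiver.Total V // e.left = v}) :
      Nonempty ({e : Quiver.Total V // e.left = v} × K ≃ K) := by
    rw [← Cardinal.eq, Cardinal.mk_prod, Cardinal.lift_id, Cardinal.lift_id]
    refine Cardinal.mul_eq_right hK ?_ (Cardinal.mk_ne_zero_iff.2 h)
    exact Cardinal.mk_le_of_injective (f := fun e => (Sum.inr e.1 : K))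
      fun e f h => Subtype.ext (Sum.inr_injective h)
  let φ (v : V) (h : Nonempty {e : Quiver.Total V // e.left = v}) := (equiv v h).some
  refine ⟨K, ⟨Sum.inl 0⟩, fun e k => φ e.left ⟨e, rfl⟩ (⟨e, rfl⟩, k), ?_, ?_⟩
  · have key (v : V) (h) (e f : Quiver.Total V) (k l : K) (he : e.left = v) (hf : f.left = v)
        (hef : φ v h (⟨e, he⟩, k) = φ v h (⟨f, hf⟩, l)) : e = f ∧ k = l := by
      simpa using (φ v h).injective hef
    have transport (v v' : V) (hv : v = v') (h h') (f : Quiver.Total V) (hf hf') (l : K) :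
        φ v h (⟨f, hf⟩, l) = φ v' h' (⟨f, hf'⟩, l) := by
      subst hv
      rfl
    intro e f k l hef h
    refine key e.left ⟨e, rfl⟩ e f k l rfl hef.symm
      (h.trans (transport _ _ hef.symm ⟨f, rfl⟩ ⟨e, rfl⟩ _ _ _ _))
  · rintro v ⟨e, he⟩ k
    obtain ⟨⟨⟨f, rfl⟩, l⟩, hl⟩ := (φ v ⟨e, he⟩).surjective k
    exact ⟨f, l, rfl, hl⟩

variable {R : Type t} [CommRing R]

/-- The operator on functions attached to a partial self-map of the underlying set. -/
def partialPullback (R : Type t) [CommRing R] {X : Type*} (f : X → Option X) :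
    Module.End R (X → R) where
  toFun φ x := (f x).elim 0 φ
  map_add' φ χ := by
    ext x
    cases h : f x <;> simp [h]
  map_smul' c φ := by
    ext x
    cases h : f x <;> simp [h]

/-- Pulling back reverses composition, so a product of generators is read from left to right, as a
path is. -/
theorem partialPullback_mul {X : Type*} (f g : X → Option X) :
    partialPullback R f * partialPullback R g = partialPullback R fun x => (f x).bind g := by
  ext φ x
  simp only [partialPullback, Module.End.mul_apply, LinearMap.coe_mk, AddHom.coe_mk]
  cases f x <;> rfl

theorem partialPullback_none {X : Type*} :
    partialPullback R (fun _ : X => none) = 0 := rfl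

variable {V : Type u} [Quiver.{w} V] {K : Type*}

open Classical in
/-- The partial self-map of `V × K` attached to a generator, given a family of maps indexed by the
edges. -/
noncomputable def branchingMap (ψ : Quiver.Total V → K → K) : Gen V → V × K → Option (V × K)
  | .vertex v => fun x => if x.1 = v then some x else none
  | .edge e => fun x =>
      if h : x.1 = e.left ∧ ∃ k, ψ e k = x.2 then some (e.right, h.2.choose) else none
  | .ghost e => fun x => if x.1 = e.right then some (e.left, ψ e x.2) else none

theorem branchingMap_edge_apply {ψ : Quiver.Total V → K → K}
    (hψ : ∀ e f k l, e.left = f.left → ψ e k = ψ f l → e = f ∧ k = l) (e : Quiver.Total V) (k : K) :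
    branchingMap ψ (.edge e) (e.left, ψ e k) = some (e.right, k) := by
  have h : ∃ l, ψ e l = ψ e k := ⟨k, rfl⟩
  have := (hψ e e _ _ rfl h.choose_spec).2
  simp [branchingMap, this]

theorem branchingMap_edge_eq_none {ψ : Quiver.Total V → K → K} {e : Quiver.Total V} {x : V × K}
    (h : ¬ ∃ k, x = (e.left, ψ e k)) : branchingMap ψ (.edge e) x = none := by
  simp only [branchingMap, dite_eq_right_iff, reduceCtorEq, imp_false]
  rintro ⟨h₁, k, h₂⟩
  exact h ⟨k, Prod.ext h₁ h₂.symm⟩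

/-- An edge strips off its branch and its ghost puts it back, so `e e*` restricts to the branch of
`e`. Injectivity and disjointness of the branches give the relations for `e* f`; the fact that they
cover gives `v = ∑ e e*`. -/
theorem freeLift_branchingMap_eq_of_rel {ψ : Quiver.Total V → K → K}
    (hψ : ∀ e f k l, e.left = f.left → ψ e k = ψ f l → e = f ∧ k = l)
    (hψ' : ∀ v : V, {e : Quiver.Total V | e.left = v}.Nonempty →
      ∀ k, ∃ e l, e.left = v ∧ ψ e l = k)
    {x y : FreeAlg R V} (h : Rel R V x y) :
    freeLift (R := R) (fun g => partialPullback R (branchingMap ψ g)) x =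
      freeLift (R := R) (fun g => partialPullback R (branchingMap ψ g)) y := by
  have edge_bind (e : Quiver.Total V) (g : V × K → Option (V × K)) (x : V × K) :
      (∃ k, x = (e.left, ψ e k) ∧ (branchingMap ψ (.edge e) x).bind g = g (e.right, k)) ∨
        (¬ (∃ k, x = (e.left, ψ e k)) ∧ (branchingMap ψ (.edge e) x).bind g = none) := by
    by_cases h : ∃ k, x = (e.left, ψ e k)
    · obtain ⟨k, rfl⟩ := h
      exact .inl ⟨k, rfl, by rw [branchingMap_edge_apply hψ]; rfl⟩
    · exact .inr ⟨h, by rw [branchingMap_edge_eq_none h]; rfl⟩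
  cases h with
  | vertex_idem v =>
    simp only [map_mul, freeLift_gen, partialPullback_mul]
    congr! 2 with x
    by_cases h : x.1 = v <;> simp [branchingMap, h]
  | vertex_orth v v' h =>
    simp only [map_mul, freeLift_gen, partialPullback_mul, map_zero]
    rw [← partialPullback_none]
    congr! 2 with x
    by_cases h' : x.1 = v
    · simp [branchingMap, h', h]
    · simp [branchingMap, h']
  | source_edge e =>
    simp only [map_mul, freeLift_gen, partialPullback_mul]
    congr! 2 with x
    by_cases h : x.1 = e.left
    · simp [branchingMap, h]
    · simp [branchingMap, h]
  | edge_range e =>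
    simp only [map_mul, freeLift_gen, partialPullback_mul]
    congr! 2 with x
    rcases edge_bind e (branchingMap ψ (.vertex e.right)) x with ⟨k, rfl, h⟩ | ⟨h, h'⟩
    · rw [h, branchingMap_edge_apply hψ]
      simp [branchingMap]
    · rw [h', branchingMap_edge_eq_none h]
  | range_ghost e =>
    simp only [map_mul, freeLift_gen, partialPullback_mul]
    congr! 2 with x
    by_cases h : x.1 = e.right <;> simp [branchingMap, h]
  | ghost_source e =>
    simp only [map_mul, freeLift_gen, partialPullback_mul]
    congr! 2 with x
    by_cases h : x.1 = e.right <;> simp [branchingMap, h]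
  | ck1_same e =>
    simp only [map_mul, freeLift_gen, partialPullback_mul]
    congr! 2 with x
    obtain ⟨v, k⟩ := x
    have := branchingMap_edge_apply hψ e k
    by_cases h : v = e.right
    · subst h
      simpa [branchingMap] using this
    · simp [branchingMap, h]
  | ck1_ne e f h =>
    simp only [map_mul, freeLift_gen, partialPullback_mul, map_zero]
    rw [← partialPullback_none]
    congr! 2 with x
    have : branchingMap ψ (.edge f) (e.left, ψ e x.2) = none := by
      refine branchingMap_edge_eq_none ?_
      rintro ⟨k, hk⟩
      rw [Prod.mk.injEq] at hk
      exact h (hψ _ _ _ _ hk.1 hk.2).1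
    by_cases h' : x.1 = e.right
    · have h₂ : branchingMap ψ (.ghost e) x = some (e.left, ψ e x.2) := by simp [branchingMap, h']
      rw [h₂]
      exact this
    · simp [branchingMap, h']
  | ck2 v hfin hne =>
    simp only [map_mul, map_sum, freeLift_gen, partialPullback_mul]
    refine LinearMap.ext fun φ => funext fun x => ?_
    rw [LinearMap.sum_apply, Finset.sum_apply]
    by_cases hx : x.1 = v
    · obtain ⟨e, k, he, hk⟩ := hψ' v hne x.2
      rw [Finset.sum_eq_single_of_mem e (by simpa using he)]
      · rcases edge_bind e (branchingMap ψ (.ghost e)) x with ⟨l, hl, h⟩ | ⟨h, -⟩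
        · simp only [partialPullback, LinearMap.coe_mk, AddHom.coe_mk, h]
          simp [branchingMap, hx, ← he, ← hl]
        · exact absurd ⟨k, Prod.ext (hx.trans he.symm) hk.symm⟩ h
      · intro f hf hfe
        have hf' : f.left = v := by simpa using hf
        rcases edge_bind f (branchingMap ψ (.ghost f)) x with ⟨l, hl, h⟩ | ⟨-, h⟩
        · refine absurd (hψ f e l k (hf'.trans he.symm) ?_).1 hfe
          rw [hk, hl]
        · simp [partialPullback, h]
    · rw [Finset.sum_eq_zero]
      · simp [partialPullback, branchingMap, hx]
      · intro f hf
        have hf' : f.left = v := by simpa using hf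
        rcases edge_bind f (branchingMap ψ (.ghost f)) x with ⟨l, hl, h⟩ | ⟨-, h⟩
        · exact absurd (by rw [hl, hf']) hx
        · simp [partialPullback, h]

/-- A vertex is annihilated by no nonzero scalar. -/
theorem eq_zero_of_smul_vertex_eq_zero {c : R} {v : V} (h : c • vertex R v = 0) : c = 0 := by
  obtain ⟨K, ⟨k⟩, ψ, hψ, hψ'⟩ := exists_branching V
  let T : LeavittPathAlgebra R V →ₙₐ[R] Module.End R (V × K → R) :=
    lift (fun g => partialPullback R (branchingMap ψ g))
      fun _ _ h => freeLift_branchingMap_eq_of_rel hψ hψ' h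
  have h₁ : c • T (vertex R v) = 0 := by rw [← map_smul, h, map_zero]
  have h₂ : T (vertex R v) = partialPullback R (branchingMap ψ (.vertex v)) := lift_gen _ _ _
  have h₃ := congrFun (LinearMap.congr_fun h₁ fun _ => 1) (v, k)
  simpa [h₂, partialPullback, branchingMap] using h₃

end Representation

/-! ### Products of paths and adjoints of paths -/

section Paths

variable {R : Type t} [CommRing R] {V : Type u} [Quiver.{w} V]

theorem vertex_mul_self (v : V) : vertex R v * vertex R v = vertex R v :=
  mk_eq_of_rel (Rel.vertex_idem v)

theorem vertex_mul_vertex_of_ne {v v' : V} (h : v ≠ v') : vertex R v * vertex R v' = 0 :=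
  mk_eq_of_rel (Rel.vertex_orth v v' h)

theorem vertex_mul_edge (e : Quiver.Total V) : vertex R e.left * edge R e = edge R e :=
  mk_eq_of_rel (Rel.source_edge e)

theorem edge_mul_vertex (e : Quiver.Total V) : edge R e * vertex R e.right = edge R e :=
  mk_eq_of_rel (Rel.edge_range e)

theorem star_vertex (v : V) : star (vertex R v) = vertex R v := star_gen _

theorem star_edge (e : Quiver.Total V) : star (edge R e) = mk (gen R (Gen.ghost e)) := star_gen _

theorem star_edge_mul_edge (e : Quiver.Total V) : star (edge R e) * edge R e = vertex R e.right := by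
  rw [star_edge]
  exact mk_eq_of_rel (Rel.ck1_same e)

theorem star_edge_mul_edge_of_ne {e f : Quiver.Total V} (h : e ≠ f) :
    star (edge R e) * edge R f = 0 := by
  rw [star_edge]
  exact mk_eq_of_rel (Rel.ck1_ne e f h)

/-- Apart from the check that the involution and the representation respect it, the relation `v = ∑
e e*` is needed only for a vertex emitting a single edge. -/
theorem edge_mul_star_edge_of_unique {e : Quiver.Total V} (h : ∀ f, f.left = e.left → f = e) :
    edge R e * star (edge R e) = vertex R e.left := by
  have hs : {f : Quiver.Total V | f.left = e.left} = {e} := by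
    ext f
    exact ⟨h f, fun hf => congrArg _ hf⟩
  have hfin : {f : Quiver.Total V | f.left = e.left}.Finite := by
    rw [hs]
    exact Set.finite_singleton e
  have hT : hfin.toFinset = {e} := by
    ext f
    simpa using ⟨h f, fun hf => congrArg _ hf⟩
  have := mk_eq_of_rel (Rel.ck2 (R := R) e.left hfin ⟨e, rfl⟩)
  rw [hT, Finset.sum_singleton, mk_mul] at this
  rw [star_edge]
  exact this.symm

theorem path_nil (a : V) : path R (.nil : Quiver.Path a a) = vertex R a := rfl

theorem path_cons {a b c : V} (α : Quiver.Path a b) (e : b ⟶ c) :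
    path R (α.cons e) = path R α * edge R ⟨b, c, e⟩ := rfl

theorem path_mul_vertex {a b : V} (α : Quiver.Path a b) : path R α * vertex R b = path R α := by
  cases α with
  | nil => exact vertex_mul_self a
  | cons α e => rw [path_cons, mul_assoc, edge_mul_vertex ⟨_, _, e⟩]

theorem vertex_mul_path {a b : V} (α : Quiver.Path a b) : vertex R a * path R α = path R α := by
  induction α with
  | nil => exact vertex_mul_self a
  | cons α e ih => rw [path_cons, ← mul_assoc, ih]

theorem vertex_mul_star_path {a b : V} (α : Quiver.Path a b) :
    vertex R b * star (path R α) = star (path R α) := by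
  rw [← star_vertex, ← star_mul, path_mul_vertex]

theorem star_path_mul_vertex {a b : V} (α : Quiver.Path a b) :
    star (path R α) * vertex R a = star (path R α) := by
  rw [← star_vertex, ← star_mul, vertex_mul_path]

theorem path_comp {a b c : V} (α : Quiver.Path a b) (β : Quiver.Path b c) :
    path R (α.comp β) = path R α * path R β := by
  induction β with
  | nil => exact (path_mul_vertex α).symm
  | cons β e ih => rw [Quiver.Path.comp_cons, path_cons, path_cons, ih, mul_assoc]

theorem path_toPath (e : Quiver.Total V) : path R e.hom.toPath = edge R e :=
  vertex_mul_edge e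

theorem star_path_mul_path_self {a b : V} (α : Quiver.Path a b) :
    star (path R α) * path R α = vertex R b := by
  induction α with
  | nil => rw [path_nil, star_vertex, vertex_mul_self]
  | @cons b c α e ih =>
    rw [path_cons, star_mul, mul_assoc, ← mul_assoc (star (path R α)), ih, vertex_mul_edge ⟨b, c, e⟩,
      star_edge_mul_edge]

theorem path_mul_star_path_mul_path {a b : V} (α : Quiver.Path a b) :
    path R α * star (path R α) * path R α = path R α := by
  rw [mul_assoc, star_path_mul_path_self, path_mul_vertex]

theorem star_path_mul_path_mul_star_path {a b : V} (α : Quiver.Path a b) :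
    star (path R α) * (path R α * star (path R α)) = star (path R α) := by
  rw [← mul_assoc, star_path_mul_path_self, vertex_mul_star_path]

theorem star_path_mul_path_of_ne {a b c d : V} (h : a ≠ b) (α : Quiver.Path a c)
    (β : Quiver.Path b d) : star (path R α) * path R β = 0 := by
  rw [← star_path_mul_vertex α, ← vertex_mul_path β, mul_assoc, ← mul_assoc (vertex R a),
    vertex_mul_vertex_of_ne h, zero_mul, mul_zero]

/-- Paths with a common source are comparable or orthogonal. -/
theorem star_path_mul_path_eq_zero_or {a c d : V} (α : Quiver.Path a c) (β : Quiver.Path a d)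
    (h : α.length ≤ β.length) :
    star (path R α) * path R β = 0 ∨ ∃ γ : Quiver.Path c d, β = α.comp γ := by
  induction β generalizing c with
  | nil =>
    have h0 : α.length = 0 := by simpa using h
    obtain rfl := α.eq_of_length_zero h0
    obtain rfl := α.eq_nil_of_length_zero h0
    exact .inr ⟨.nil, rfl⟩
  | @cons d d' β f ih =>
    rcases h.lt_or_eq with h | h
    · rcases ih α (Nat.lt_succ_iff.1 h) with h0 | ⟨γ, rfl⟩
      · exact .inl (by rw [path_cons, ← mul_assoc, h0, zero_mul])
      · exact .inr ⟨γ.cons f, rfl⟩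
    -- For equal lengths the paths without their last edges are orthogonal or equal; in the second
    -- case the last edges decide.
    · cases α with
      | nil => simp at h
      | @cons b _ α e =>
        have h : α.length = β.length := by simpa using h
        rcases ih α h.le with h0 | ⟨γ, hγ⟩
        · left
          rw [path_cons, path_cons, star_mul, mul_assoc, ← mul_assoc (star (path R α)), h0, zero_mul,
            mul_zero]
        · have hγ0 : γ.length = 0 := by
            have := congrArg Quiver.Path.length hγ
            rw [Quiver.Path.length_comp] at this
            omega
          obtain rfl := γ.eq_of_length_zero hγ0
          obtain rfl := γ.eq_nil_of_length_zero hγ0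
          obtain rfl : β = α := hγ
          by_cases hef : (⟨_, _, e⟩ : Quiver.Total V) = ⟨_, _, f⟩
          · obtain ⟨-, rfl, hef⟩ := Quiver.Total.mk.inj hef
            obtain rfl := eq_of_heq hef
            exact .inr ⟨.nil, rfl⟩
          · left
            rw [path_cons, path_cons, star_mul, mul_assoc, ← mul_assoc (star (path R β)),
              star_path_mul_path_self, vertex_mul_edge ⟨_, _, f⟩, star_edge_mul_edge_of_ne hef]

theorem star_mul_eq_zero_comm {x y : LeavittPathAlgebra R V} :
    star x * y = 0 ↔ star y * x = 0 := by
  constructor <;> intro h <;> simpa using congrArg star h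

/-- The three possible values of a product `α* β`. -/
theorem star_path_mul_path_cases {a b c d : V} (α : Quiver.Path a c) (β : Quiver.Path b d) :
    star (path R α) * path R β = 0 ∨
      (∃ γ : Quiver.Path c d, path R β = path R α * path R γ ∧
        star (path R α) * path R β = path R γ ∧ β.length = α.length + γ.length) ∨
      ∃ γ : Quiver.Path d c, path R α = path R β * path R γ ∧
        star (path R α) * path R β = star (path R γ) ∧ α.length = β.length + γ.length := by
  by_cases hab : a = b
  · subst hab
    rcases le_total α.length β.length with h | h
    · rcases star_path_mul_path_eq_zero_or (R := R) α β h with h | ⟨γ, rfl⟩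
      · exact .inl h
      · exact .inr (.inl ⟨γ, path_comp α γ,
          by rw [path_comp, ← mul_assoc, star_path_mul_path_self, vertex_mul_path],
          Quiver.Path.length_comp _ _⟩)
    · rcases star_path_mul_path_eq_zero_or (R := R) β α h with h | ⟨γ, rfl⟩
      · exact .inl (star_mul_eq_zero_comm.1 h)
      · exact .inr (.inr ⟨γ, path_comp β γ,
          by rw [path_comp, star_mul, mul_assoc, star_path_mul_path_self, star_path_mul_vertex],
          Quiver.Path.length_comp _ _⟩)
  · exact .inl (star_path_mul_path_of_ne hab α β)

theorem path_ne_zero [Nontrivial R] {a b : V} (α : Quiver.Path a b) : path R α ≠ 0 := by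
  intro h
  have := star_path_mul_path_self (R := R) α
  rw [h, mul_zero] at this
  exact one_ne_zero (eq_zero_of_smul_vertex_eq_zero (c := (1 : R)) (v := b)
    (by rw [← this, smul_zero]))

end Paths

/-! ### The spanning set of elements `α β*` -/

section Spanning

variable {R : Type t} [CommRing R] {V : Type u} [Quiver.{w} V]

theorem path_mul_star_path_mem_generators {a b c : V} (α : Quiver.Path a c) (β : Quiver.Path b c) :
    path R α * star (path R β) ∈ generators R V :=
  ⟨a, b, c, α, β, rfl⟩

theorem mul_mem_span_generators {x y : LeavittPathAlgebra R V}
    (hx : x ∈ Submodule.span R (generators R V)) (hy : y ∈ Submodule.span R (generators R V)) :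
    x * y ∈ Submodule.span R (generators R V) := by
  induction hx, hy using Submodule.span_induction₂ with
  | mem_mem x y hx hy =>
    obtain ⟨a, b, c, α, β, rfl⟩ := hx
    obtain ⟨d, e, f, γ, δ, rfl⟩ := hy
    have h : path R α * star (path R β) * (path R γ * star (path R δ)) =
        path R α * (star (path R β) * path R γ) * star (path R δ) := by simp only [mul_assoc]
    rw [h]
    rcases star_path_mul_path_cases (R := R) β γ with h | ⟨η, -, h, -⟩ | ⟨η, -, h, -⟩
    · rw [h, mul_zero, zero_mul]
      exact zero_mem _
    · rw [h, ← path_comp]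
      exact Submodule.subset_span (path_mul_star_path_mem_generators _ _)
    · rw [h, mul_assoc, ← star_mul, ← path_comp]
      exact Submodule.subset_span (path_mul_star_path_mem_generators _ _)
  | zero_left y hy => rw [zero_mul]; exact zero_mem _
  | zero_right x hx => rw [mul_zero]; exact zero_mem _
  | add_left x y z _ _ _ h₁ h₂ => rw [add_mul]; exact add_mem h₁ h₂
  | add_right x y z _ _ _ h₁ h₂ => rw [mul_add]; exact add_mem h₁ h₂
  | smul_left r x y _ _ h => rw [smul_mul_assoc]; exact Submodule.smul_mem _ _ h
  | smul_right r x y _ _ h => rw [mul_smul_comm]; exact Submodule.smul_mem _ _ h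

theorem mk_gen_mem_span_generators (g : Gen V) :
    (mk (gen R g) : LeavittPathAlgebra R V) ∈ Submodule.span R (generators R V) := by
  cases g with
  | vertex v =>
    refine Submodule.subset_span ⟨v, v, v, .nil, .nil, ?_⟩
    rw [path_nil, star_vertex, vertex_mul_self]
    rfl
  | edge e =>
    refine Submodule.subset_span ⟨e.left, e.right, e.right, e.hom.toPath, .nil, ?_⟩
    rw [path_nil, star_vertex, path_mul_vertex, path_toPath]
    rfl
  | ghost e =>
    refine Submodule.subset_span ⟨e.right, e.left, e.right, .nil, e.hom.toPath, ?_⟩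
    rw [path_nil, vertex_mul_star_path, path_toPath, star_edge]

/-- The Leavitt path algebra is spanned by the elements `α β*`. -/
theorem span_generators : Submodule.span R (generators R V) = ⊤ := by
  rw [eq_top_iff]
  rintro x -
  obtain ⟨x, rfl⟩ := mk_surjective x
  induction x using MonoidAlgebra.induction_linear with
  | zero => exact zero_mem _
  | add x y hx hy =>
    rw [mk_add]
    exact add_mem hx hy
  | single m r =>
    rw [show (MonoidAlgebra.single m r : FreeAlg R V) = r • MonoidAlgebra.single m 1 by simp,
      mk_smul]
    refine Submodule.smul_mem _ _ ?_
    induction m using FreeSemigroup.recOnMul with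
    | ih1 g => exact mk_gen_mem_span_generators g
    | ih2 g m hg hm =>
      have h : (MonoidAlgebra.single (FreeSemigroup.of g * m) 1 : FreeAlg R V) =
          MonoidAlgebra.single (FreeSemigroup.of g) 1 * MonoidAlgebra.single m 1 := by
        simp [MonoidAlgebra.single_mul_single]
      rw [h, mk_mul]
      exact mul_mem_span_generators hg hm

/-- To prove a property of all elements, it is enough to prove it for the elements `α β*`, and that
it is stable under linear combinations. -/
theorem generators_induction {p : LeavittPathAlgebra R V → Prop}
    (gen : ∀ (a b c : V) (α : Quiver.Path a c) (β : Quiver.Path b c),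
      p (path R α * star (path R β)))
    (zero : p 0) (add : ∀ x y, p x → p y → p (x + y)) (smul : ∀ (r : R) x, p x → p (r • x))
    (x : LeavittPathAlgebra R V) : p x := by
  have hx : x ∈ Submodule.span R (generators R V) := by
    rw [span_generators]
    exact Submodule.mem_top
  induction hx using Submodule.span_induction with
  | mem x hx =>
    obtain ⟨a, b, c, α, β, rfl⟩ := hx
    exact gen a b c α β
  | zero => exact zero
  | add x y _ _ hx hy => exact add x y hx hy
  | smul r x _ hx => exact smul r x hx

end Spanning

/-! ### Closed paths without exit and normal generators -/

section NoExit

variable {R : Type t} [CommRing R] {V : Type u} [Quiver.{w} V]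

/-- The powers of a closed path. -/
def pathPow {a : V} (η : Quiver.Path a a) : ℕ → Quiver.Path a a
  | 0 => .nil
  | n + 1 => η.comp (pathPow η n)

theorem length_pathPow {a : V} (η : Quiver.Path a a) (n : ℕ) :
    (pathPow η n).length = n * η.length := by
  induction n with
  | zero => simp [pathPow]
  | succ n ih => rw [pathPow, Quiver.Path.length_comp, ih, Nat.succ_mul, add_comm]

theorem pathPow_add {a : V} (η : Quiver.Path a a) (m n : ℕ) :
    pathPow η (m + n) = (pathPow η m).comp (pathPow η n) := by
  induction m with
  | zero => simp [pathPow]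
  | succ m ih => rw [Nat.succ_add, pathPow, pathPow, ih, Quiver.Path.comp_assoc]

theorem path_comp_mul_star {a b c : V} (α : Quiver.Path a b) (β : Quiver.Path b c)
    (h : path R β * star (path R β) = vertex R b) :
    path R (α.comp β) * star (path R (α.comp β)) = path R α * star (path R α) := by
  rw [path_comp, star_mul, mul_assoc, ← mul_assoc (path R β), h, vertex_mul_star_path]

theorem pathPow_mul_star {a : V} {η : Quiver.Path a a}
    (h : path R η * star (path R η) = vertex R a) (n : ℕ) :
    path R (pathPow η n) * star (path R (pathPow η n)) = vertex R a := by
  induction n with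
  | zero => rw [pathPow, path_nil, star_vertex, vertex_mul_self]
  | succ n ih => rw [pathPow, path_comp_mul_star _ _ ih, h]

/-- The projection of `α β` lies below that of `α`, which lies below the vertex `a`. -/
theorem path_comp_mul_star_eq_vertex {a b c : V} {α : Quiver.Path a b} {β : Quiver.Path b c}
    (h : path R (α.comp β) * star (path R (α.comp β)) = vertex R a) :
    path R α * star (path R α) = vertex R a := by
  calc path R α * star (path R α)
      = path R α * star (path R α) * (path R (α.comp β) * star (path R (α.comp β))) := by
        rw [h, mul_assoc, star_path_mul_vertex]
    _ = vertex R a := by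
        rw [← mul_assoc, path_comp, ← mul_assoc (path R α * _), path_mul_star_path_mul_path,
          ← path_comp, h]

theorem diagonal_generators_commute {a b c d : V} (α : Quiver.Path a c) (β : Quiver.Path b d) :
    path R α * star (path R α) * (path R β * star (path R β)) =
      path R β * star (path R β) * (path R α * star (path R α)) := by
  have key {a b c d : V} (α : Quiver.Path a c) (β : Quiver.Path b d)
      (γ : Quiver.Path c d) (h : path R β = path R α * path R γ) :
      path R α * star (path R α) * (path R β * star (path R β)) =
        path R β * star (path R β) * (path R α * star (path R α)) := by
    have h₁ : path R α * star (path R α) * path R β = path R β := by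
      rw [h, ← mul_assoc, path_mul_star_path_mul_path]
    have h₂ : star (path R β) * (path R α * star (path R α)) = star (path R β) := by
      simpa using congrArg star h₁
    rw [← mul_assoc, h₁, mul_assoc (path R β), h₂]
  rcases star_path_mul_path_cases (R := R) α β with h | ⟨γ, h, -⟩ | ⟨γ, h, -⟩
  · have h' := star_mul_eq_zero_comm.1 h
    rw [mul_assoc, ← mul_assoc (star (path R α)), h, mul_assoc (path R β),
      ← mul_assoc (star (path R β)), h']
    simp
  · exact key α β γ h
  · exact (key β α γ h).symm

variable [Nontrivial R]

/-- A path from `a` orthogonal to `α` would be annihilated by `α α* = a`, hence be zero. -/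
theorem exists_eq_comp_of_mul_star_eq_vertex {a b c : V} {α : Quiver.Path a b}
    {β : Quiver.Path a c} (hα : path R α * star (path R α) = vertex R a)
    (h : α.length ≤ β.length) : ∃ γ : Quiver.Path b c, β = α.comp γ := by
  rcases star_path_mul_path_eq_zero_or (R := R) α β h with h0 | h
  · refine absurd ?_ (path_ne_zero (R := R) β)
    rw [← vertex_mul_path, ← hα, mul_assoc, h0, mul_zero]
  · exact h

theorem eq_of_mul_star_eq_vertex {a b : V} {α β : Quiver.Path a b}
    (hα : path R α * star (path R α) = vertex R a) (h : α.length = β.length) : α = β := by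
  obtain ⟨γ, hγ⟩ := exists_eq_comp_of_mul_star_eq_vertex hα h.le
  have := congrArg Quiver.Path.length hγ
  rw [Quiver.Path.length_comp] at this
  obtain rfl := γ.eq_nil_of_length_zero (by omega)
  exact hγ.symm

/-- If a cycle has no exit then no path starting on it has an exit. -/
theorem path_mul_star_eq_vertex {a b : V} {η : Quiver.Path a a}
    (h : path R η * star (path R η) = vertex R a) (hη : 0 < η.length) (ε : Quiver.Path a b) :
    path R ε * star (path R ε) = vertex R a := by
  -- A power of `η` at least as long as `ε` has full projection, so `ε` must be an initial segment
  -- of it.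
  have hpow := pathPow_mul_star h ε.length
  have hlen : ε.length ≤ (pathPow η ε.length).length := by
    rw [length_pathPow]
    exact Nat.le_mul_of_pos_right _ hη
  rcases star_path_mul_path_eq_zero_or (R := R) ε _ hlen with h0 | ⟨γ, hγ⟩
  · refine absurd ?_ (path_ne_zero (R := R) ε)
    rw [← vertex_mul_path, ← hpow, mul_assoc, star_mul_eq_zero_comm.1 h0, mul_zero]
  · rw [hγ] at hpow
    exact path_comp_mul_star_eq_vertex hpow

/-- A normal element `β η β*`, with `η` a closed path without exit, commutes with the diagonal. -/
theorem conj_path_commute_diagonal {a b c d : V} {η : Quiver.Path a a}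
    (h : path R η * star (path R η) = vertex R a) (β : Quiver.Path b a) (γ : Quiver.Path c d) :
    path R β * path R η * star (path R β) * (path R γ * star (path R γ)) =
      path R γ * star (path R γ) * (path R β * path R η * star (path R β)) := by
  -- A path of length zero satisfies the hypothesis even if `a` has exits, so it needs the
  -- commutativity of the diagonal instead.
  rcases Nat.eq_zero_or_pos η.length with h0 | hη
  · obtain rfl := η.eq_nil_of_length_zero h0
    rw [path_nil, path_mul_vertex]
    exact diagonal_generators_commute β γ
  rcases star_path_mul_path_cases (R := R) β γ with h' | ⟨ε, hε, -⟩ | ⟨ε, hε, -⟩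
  · have h₁ (x) : star (path R β) * (path R γ * x) = 0 := by rw [← mul_assoc, h', zero_mul]
    have h₂ (x) : star (path R γ) * (path R β * x) = 0 := by
      rw [← mul_assoc, star_mul_eq_zero_comm.1 h', zero_mul]
    simp only [mul_assoc, h₁, h₂, mul_zero]
  · have hγ : path R γ * star (path R γ) = path R β * star (path R β) := by
      rw [hε, star_mul, mul_assoc, ← mul_assoc (path R ε), path_mul_star_eq_vertex h hη ε,
        vertex_mul_star_path]
    rw [hγ, mul_assoc _ (star (path R β)), star_path_mul_path_mul_star_path, ← mul_assoc,
      ← mul_assoc, path_mul_star_path_mul_path]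
  · have h₁ : path R γ * star (path R γ) * path R β = path R β := by
      rw [hε, ← mul_assoc, path_mul_star_path_mul_path]
    have h₂ : star (path R β) * (path R γ * star (path R γ)) = star (path R β) := by
      simpa using congrArg star h₁
    rw [mul_assoc _ (star (path R β)), h₂, ← mul_assoc, ← mul_assoc, h₁]

/-- Normal elements `β η β*`, with `η` a closed path without exit, commute. -/
theorem conj_path_commute {a b c d : V} {η : Quiver.Path a a} {θ : Quiver.Path c c}
    (hη : path R η * star (path R η) = vertex R a) (hθ : path R θ * star (path R θ) = vertex R c)
    (β : Quiver.Path b a) (δ : Quiver.Path d c) :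
    path R β * path R η * star (path R β) * (path R δ * path R θ * star (path R δ)) =
      path R δ * path R θ * star (path R δ) * (path R β * path R η * star (path R β)) := by
  have key {a b c d : V} {η : Quiver.Path a a} {θ : Quiver.Path c c}
      (hη : path R η * star (path R η) = vertex R a)
      (hθ : path R θ * star (path R θ) = vertex R c)
      (β : Quiver.Path b a) (δ : Quiver.Path d c) (ε : Quiver.Path a c)
      (hε : path R δ = path R β * path R ε) :
      path R β * path R η * star (path R β) * (path R δ * path R θ * star (path R δ)) =
        path R δ * path R θ * star (path R δ) * (path R β * path R η * star (path R β)) := by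
    rcases Nat.eq_zero_or_pos η.length with h0 | h0
    · obtain rfl := η.eq_nil_of_length_zero h0
      rw [path_nil, path_mul_vertex]
      exact (conj_path_commute_diagonal hθ δ β).symm
    have hε' := path_mul_star_eq_vertex hη h0 ε
    -- Since `ε` has no exit it begins `η ε`; the remainder `η'` is `η` transported along `ε` to a
    -- closed path at `c`, where it can be compared with `θ`.
    obtain ⟨η', hη'⟩ := exists_eq_comp_of_mul_star_eq_vertex (β := η.comp ε) hε'
      (by rw [Quiver.Path.length_comp]; omega)
    have hcomm : path R ε * path R η' * path R θ = path R ε * path R θ * path R η' := by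
      rw [← path_comp, ← path_comp, ← path_comp, ← path_comp]
      congr 1
      -- Two paths from `a` to `c` of equal length coincide, because nothing starting at `a` has an
      -- exit.
      refine eq_of_mul_star_eq_vertex (R := R) (path_mul_star_eq_vertex hη h0 _) ?_
      simp only [Quiver.Path.length_comp]
      omega
    have hηε : path R η * path R ε = path R ε * path R η' := by
      rw [← path_comp, ← path_comp, hη']
    have h₁ : path R β * path R η * star (path R β) * path R δ = path R δ * path R η' := by
      rw [hε, mul_assoc (path R β * _), ← mul_assoc (star (path R β)), star_path_mul_path_self,
        vertex_mul_path, mul_assoc, hηε, mul_assoc]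
    have h₂ : star (path R δ) * (path R β * path R η * star (path R β)) =
        path R η' * star (path R δ) := by
      rw [hε, star_mul, mul_assoc (star (path R ε)), ← mul_assoc (star (path R β)),
        ← mul_assoc (star (path R β)), star_path_mul_path_self, vertex_mul_path]
      have : path R η = path R ε * path R η' * star (path R ε) := by
        rw [← hηε, mul_assoc, hε', path_mul_vertex]
      rw [this, mul_assoc (path R ε), ← mul_assoc (star (path R ε)), ← mul_assoc (star (path R ε)),
        star_path_mul_path_self, ← mul_assoc (vertex R c), vertex_mul_path, mul_assoc]
    rw [← mul_assoc, ← mul_assoc, h₁, mul_assoc (path R δ * path R θ), h₂, ← mul_assoc, hε,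
      mul_assoc (path R β), mul_assoc (path R β), hcomm]
    simp only [mul_assoc]
  rcases star_path_mul_path_cases (R := R) β δ with h | ⟨ε, hε, -⟩ | ⟨ε, hε, -⟩
  · have h₁ (x) : star (path R β) * (path R δ * x) = 0 := by rw [← mul_assoc, h, zero_mul]
    have h₂ (x) : star (path R δ) * (path R β * x) = 0 := by
      rw [← mul_assoc, star_mul_eq_zero_comm.1 h, zero_mul]
    simp only [mul_assoc, h₁, h₂, mul_zero]
  · exact key hη hθ β δ ε hε
  · exact (key hθ hη δ β ε hε).symm

/-- A normal element `α β*` or its adjoint is of the form `β η β*`, with `η` a closed path without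
exit. -/
theorem exists_conj_path_of_isStarNormal {x : LeavittPathAlgebra R V} (hx : x ∈ generators R V)
    (hn : IsStarNormal x) :
    ∃ (a b : V) (β : Quiver.Path b a) (η : Quiver.Path a a),
      path R η * star (path R η) = vertex R a ∧
        (x = path R β * path R η * star (path R β) ∨
          star x = path R β * path R η * star (path R β)) := by
  obtain ⟨a, b, c, α, β, rfl⟩ := hx
  have h : path R α * star (path R α) = path R β * star (path R β) := by
    have := hn.star_comm_self.eq
    rw [star_mul, star_star, mul_assoc, ← mul_assoc (star (path R α)), star_path_mul_path_self,
      vertex_mul_star_path, mul_assoc, ← mul_assoc (star (path R β)), star_path_mul_path_self,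
      vertex_mul_star_path] at this
    exact this.symm
  have key {a b : V} (α : Quiver.Path a c) (β : Quiver.Path b c) (η : Quiver.Path c c)
      (hη : path R α = path R β * path R η)
      (h : path R α * star (path R α) = path R β * star (path R β)) :
      path R η * star (path R η) = vertex R c ∧
        path R α * star (path R β) = path R β * path R η * star (path R β) := by
    refine ⟨?_, by rw [hη]⟩
    have h₁ : star (path R β) * path R α = path R η := by
      rw [hη, ← mul_assoc, star_path_mul_path_self, vertex_mul_path]
    calc path R η * star (path R η)
        = star (path R β) * (path R α * star (path R α)) * path R β := by
          rw [← h₁, star_mul, star_star]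
          simp only [mul_assoc]
      _ = vertex R c := by
          rw [h, star_path_mul_path_mul_star_path, star_path_mul_path_self]
  rcases star_path_mul_path_cases (R := R) β α with h0 | ⟨η, hη, -⟩ | ⟨η, hη, -⟩
  -- Orthogonality is impossible: `α = α α* α = β β* α` would vanish.
  · refine absurd ?_ (path_ne_zero (R := R) α)
    rw [← path_mul_star_path_mul_path, h, mul_assoc, h0, mul_zero]
  · obtain ⟨h₁, h₂⟩ := key α β η hη h
    exact ⟨c, b, β, η, h₁, .inl h₂⟩
  · obtain ⟨h₁, h₂⟩ := key β α η hη h.symm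
    exact ⟨c, a, α, η, h₁, .inr (by rw [star_mul, star_star, h₂])⟩

end NoExit

/-! ### Closed paths with an exit -/

section Exit

variable {R : Type t} [CommRing R] {V : Type u} [Quiver.{w} V]

/-- Either a path satisfies `α α* = s(α)` or it has an exit. -/
theorem path_mul_star_eq_vertex_or_exists_exit {a b : V} (α : Quiver.Path a b) :
    path R α * star (path R α) = vertex R a ∨
      ∃ (c d d' : V) (μ : Quiver.Path a c) (e : c ⟶ d) (ν : Quiver.Path d b) (f : c ⟶ d'),
        α = (μ.cons e).comp ν ∧ (⟨c, d, e⟩ : Quiver.Total V) ≠ ⟨c, d', f⟩ := by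
  induction α with
  | nil => exact .inl (by rw [path_nil, star_vertex, vertex_mul_self])
  | @cons b b' α e ih =>
    rcases ih with ih | ⟨c, d, d', μ, e', ν, f, rfl, hf⟩
    · by_cases he : ∀ f : Quiver.Total V, f.left = b → f = ⟨b, b', e⟩
      · left
        rw [path_cons, star_mul, mul_assoc, ← mul_assoc (edge R _),
          edge_mul_star_edge_of_unique (e := ⟨b, b', e⟩) he, vertex_mul_star_path, ih]
      · push Not at he
        obtain ⟨⟨c, d, f⟩, rfl, hf⟩ := he
        exact .inr ⟨c, b', d, α, e, .nil, f, rfl, hf.symm⟩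
    · exact .inr ⟨c, d, d', μ, e', ν.cons e, f, rfl, hf⟩

theorem pathPow_comp_eq {a b : V} {η : Quiver.Path a a} {δ : Quiver.Path a b}
    {ε : Quiver.Path b b} (h : η.comp δ = δ.comp ε) (k : ℕ) :
    (pathPow η k).comp δ = δ.comp (pathPow ε k) := by
  induction k with
  | zero => simp [pathPow]
  | succ k ih =>
    rw [pathPow, pathPow, Quiver.Path.comp_assoc, ih, ← Quiver.Path.comp_assoc, h,
      Quiver.Path.comp_assoc]

/-- If a closed path has an exit, then there is a path that is not an initial segment of any of its
translates by short closed paths. -/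
theorem exists_path_star_mul_closed_mul_eq_zero [Nontrivial R] {a c d d' : V}
    (μ : Quiver.Path a c) (e : c ⟶ d) (ν : Quiver.Path d a) (f : c ⟶ d')
    (hef : (⟨c, d, e⟩ : Quiver.Total V) ≠ ⟨c, d', f⟩) (m : ℕ) :
    ∃ (b : V) (δ : Quiver.Path a b), ∀ η : Quiver.Path a a, 0 < η.length → η.length ≤ m →
      star (path R δ) * path R η * path R δ = 0 := by
  let ω := (μ.cons e).comp ν
  -- The path `δ` runs `m` times around `ω` and then leaves through `f`. As `|η| ≤ m`, it begins
  -- with `ω ^ |η|`.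
  refine ⟨d', (pathPow ω m).comp (μ.cons f), fun η hη hm => ?_⟩
  obtain ⟨k, rfl⟩ := Nat.exists_eq_add_of_le hm
  generalize hδ : (pathPow ω (η.length + k)).comp (μ.cons f) = δ
  rw [mul_assoc, ← path_comp]
  refine (star_path_mul_path_eq_zero_or (R := R) δ (η.comp δ)
    (by rw [Quiver.Path.length_comp]; omega)).resolve_right ?_
  rintro ⟨ε, hε⟩
  -- From `η δ = δ ε` follows `η ^ |ω| δ = δ ε ^ |ω|`. The paths `η ^ |ω|` and `ω ^ |η|` have equal
  -- length, so they cancel as initial segments, leaving `δ = ω ^ k μ f ε ^ |ω|`.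
  have h₁ := pathPow_comp_eq hε ω.length
  nth_rw 2 [← hδ] at h₁
  rw [pathPow_add, Quiver.Path.comp_assoc, Quiver.Path.comp_assoc] at h₁
  have h₂ := ((Quiver.Path.comp_inj' (by
    rw [length_pathPow, length_pathPow, mul_comm])).1 h₁).2
  rw [← hδ, add_comm, pathPow_add, Quiver.Path.comp_assoc, Quiver.Path.comp_inj_right] at h₂
  -- Now `ω ^ |η| μ f = μ f ε ^ |ω|` with `|η| > 0`: the left side continues `μ` by `e`, the right
  -- side by `f`.
  obtain ⟨p, hp⟩ := Nat.exists_eq_succ_of_ne_zero hη.ne'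
  rw [hp, pathPow, Quiver.Path.comp_assoc, Quiver.Path.comp_assoc] at h₂
  have h₃ := congrArg (path R) h₂
  generalize ν.comp ((pathPow ω p).comp (μ.cons f)) = κ at h₃
  rw [path_comp, path_comp, path_cons, path_cons] at h₃
  have h₄ := congrArg (fun x => star (edge R ⟨c, d, e⟩) * (star (path R μ) * x)) h₃
  simp only [mul_assoc] at h₄
  rw [← mul_assoc (star (path R μ)), ← mul_assoc (star (path R μ)), star_path_mul_path_self,
    ← mul_assoc (vertex R c), ← mul_assoc (vertex R c), vertex_mul_edge ⟨c, d, e⟩,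
    vertex_mul_edge ⟨c, d', f⟩, ← mul_assoc, ← mul_assoc, star_edge_mul_edge,
    star_edge_mul_edge_of_ne hef, zero_mul, vertex_mul_path] at h₄
  exact path_ne_zero κ h₄

end Exit

/-! ### Compressions to a vertex -/

section Closed

variable {R : Type t} [CommRing R] {V : Type u} [Quiver.{w} V]

/-- The closed paths at a vertex and their adjoints. -/
noncomputable def closedGenerator (R : Type t) [CommRing R] {V : Type u} [Quiver.{w} V] (a : V) :
    Quiver.Path a a ⊕ Quiver.Path a a → LeavittPathAlgebra R V :=
  Sum.elim (fun γ => path R γ) (fun γ => star (path R γ))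

/-- A `β` this long absorbs every ghost path occurring in `x`: what is left is `β*` times a path
ending at `a`, and this is zero, a closed path or the adjoint of one. -/
theorem star_path_mul_span_mul_path_mem {N : ℕ} {x : LeavittPathAlgebra R V}
    (hx : x ∈ Submodule.span R {y | ∃ (a b c : V) (α : Quiver.Path a c) (β : Quiver.Path b c),
      β.length ≤ N ∧ y = path R α * star (path R β)})
    {a b : V} (β : Quiver.Path b a) (hβ : N ≤ β.length) :
    star (path R β) * x * path R β ∈ Submodule.span R (Set.range (closedGenerator R a)) := by
  induction hx using Submodule.span_induction with
  | mem x hx =>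
    obtain ⟨a', b', c, α, β', hN, rfl⟩ := hx
    have h : star (path R β) * (path R α * star (path R β')) * path R β =
      star (path R β) * (path R α * (star (path R β') * path R β)) := by simp only [mul_assoc]
    rw [h]
    have key (γ : Quiver.Path c a) : star (path R β) * (path R α * path R γ) ∈
        Submodule.span R (Set.range (closedGenerator R a)) := by
      rw [← path_comp]
      rcases star_path_mul_path_cases (R := R) β (α.comp γ) with h | ⟨η, -, h, -⟩ | ⟨η, -, h, -⟩
      · rw [h]
        exact zero_mem _
      · exact Submodule.subset_span ⟨.inl η, h.symm⟩
      · exact Submodule.subset_span ⟨.inr η, h.symm⟩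
    rcases star_path_mul_path_cases (R := R) β' β with h | ⟨γ, -, h, -⟩ | ⟨γ, -, h, hlen⟩
    · rw [h, mul_zero, mul_zero]
      exact zero_mem _
    · rw [h]
      exact key γ
    · have hγ : γ.length = 0 := by omega
      obtain rfl := γ.eq_of_length_zero hγ
      obtain rfl := γ.eq_nil_of_length_zero hγ
      rw [h, path_nil, star_vertex, ← path_nil]
      exact key .nil
  | zero => rw [mul_zero, zero_mul]; exact zero_mem _
  | add x y _ _ hx hy => rw [mul_add, add_mul]; exact add_mem hx hy
  | smul r x _ hx => rw [mul_smul_comm, smul_mul_assoc]; exact Submodule.smul_mem _ _ hx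

theorem star_path_mul_star_mul_path_eq_zero {a b : V} {δ : Quiver.Path a b} {N : ℕ}
    (hδ : ∀ η : Quiver.Path a a, 0 < η.length → η.length ≤ N + N →
      star (path R δ) * path R η * path R δ = 0)
    {γ γ' : Quiver.Path a a} (h : γ ≠ γ') (hγ : γ.length ≤ N) (hγ' : γ'.length ≤ N) :
    star (path R δ) * (star (path R γ) * path R γ') * path R δ = 0 := by
  have key {γ γ' : Quiver.Path a a} (h : γ ≠ γ') (hγ' : γ'.length ≤ N)
      (hle : γ.length ≤ γ'.length) :
      star (path R δ) * (star (path R γ) * path R γ') * path R δ = 0 := by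
    rcases star_path_mul_path_eq_zero_or (R := R) γ γ' hle with h0 | ⟨η, rfl⟩
    · rw [h0, mul_zero, zero_mul]
    · rw [path_comp, ← mul_assoc (star (path R γ)), star_path_mul_path_self, vertex_mul_path]
      rw [Quiver.Path.length_comp] at hγ'
      refine hδ η (Nat.pos_of_ne_zero fun h0 => h ?_) (by omega)
      rw [η.eq_nil_of_length_zero h0, Quiver.Path.comp_nil]
  rcases le_total γ.length γ'.length with hle | hle
  · exact key h hγ' hle
  · simpa [mul_assoc] using congrArg star (key h.symm hγ hle)

/-- A combination of closed paths and their adjoints that commutes with the diagonal is scalar, as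
soon as some closed path has an exit. -/
theorem exists_eq_smul_vertex [Nontrivial R] {a : V} {μ : Quiver.Path a a}
    (hμ : path R μ * star (path R μ) ≠ vertex R a) {z : LeavittPathAlgebra R V}
    (hz : z ∈ Submodule.span R (Set.range (closedGenerator R a)))
    (hcomm : ∀ (b : V) (δ : Quiver.Path a b),
      z * (path R δ * star (path R δ)) = path R δ * star (path R δ) * z) :
    ∃ c : R, z = c • vertex R a := by
  obtain ⟨c, d, d', μ', e, ν, f, -, hef⟩ :=
    (path_mul_star_eq_vertex_or_exists_exit (R := R) μ).resolve_left hμ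
  obtain ⟨l, rfl⟩ := Finsupp.mem_span_range_iff_exists_finsupp.1 hz
  let len : Quiver.Path a a ⊕ Quiver.Path a a → ℕ :=
    Sum.elim Quiver.Path.length Quiver.Path.length
  let N := l.support.sup len
  have hN (i) (hi : i ∈ l.support) : len i ≤ N := Finset.le_sup hi
  -- The bound is `N + N` because products of two closed paths of length at most `N` occur below.
  obtain ⟨b, δ, hδ⟩ := exists_path_star_mul_closed_mul_eq_zero (R := R) μ' e ν f hef (N + N)
  have hδ' (η : Quiver.Path a a) (h₁ : 0 < η.length) (h₂ : η.length ≤ N + N) :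
      star (path R δ) * star (path R η) * path R δ = 0 := by
    simpa [mul_assoc] using congrArg star (hδ η h₁ h₂)
  set z := l.sum fun i r => r • closedGenerator R a i with hz_def
  have hzδ : z * path R δ = path R δ * star (path R δ) * z * path R δ := by
    rw [← hcomm, mul_assoc z, path_mul_star_path_mul_path]
  have hδz : star (path R δ) * z = star (path R δ) * z * (path R δ * star (path R δ)) := by
    rw [mul_assoc, hcomm, ← mul_assoc, star_path_mul_path_mul_star_path]
  have hlen (i) (hi : i ∈ l.support) : len i = 0 := by
    by_contra h0
    refine Finsupp.mem_support_iff.1 hi ?_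
    have h0 := Nat.pos_of_ne_zero h0
    have hi' := hN i hi
    rcases i with γ | γ
    -- Compression by `δ` isolates the coefficient of `γ` in `γ* z`. Yet it also gives zero, since
    -- `z δ = δ δ* z δ` produces the factor `δ* γ* δ`.
    · have h₁ : star (path R δ) * (star (path R γ) * z) * path R δ = l (.inl γ) • vertex R b := by
        rw [hz_def, Finsupp.sum, Finset.mul_sum, Finset.mul_sum, Finset.sum_mul,
          Finset.sum_eq_single_of_mem _ hi]
        · simp only [mul_smul_comm, smul_mul_assoc, closedGenerator, Sum.elim_inl]
          rw [star_path_mul_path_self, star_path_mul_vertex, star_path_mul_path_self]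
        · rintro (γ' | γ') hj hne
          · simp only [mul_smul_comm, smul_mul_assoc, closedGenerator, Sum.elim_inl]
            rw [star_path_mul_star_mul_path_eq_zero hδ (fun h => hne (by rw [h])) hi' (hN _ hj),
              smul_zero]
          · simp only [mul_smul_comm, smul_mul_assoc, closedGenerator, Sum.elim_inr]
            have := hN _ hj
            change γ'.length ≤ N at this
            change γ.length ≤ N at hi'
            change 0 < γ.length at h0
            rw [← star_mul, ← path_comp, hδ' _ (by rw [Quiver.Path.length_comp]; omega)
              (by rw [Quiver.Path.length_comp]; omega), smul_zero]
      refine eq_zero_of_smul_vertex_eq_zero (h₁.symm.trans ?_)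
      rw [← mul_assoc, mul_assoc _ z, hzδ, ← mul_assoc, ← mul_assoc, ← mul_assoc,
        hδ' γ h0 (le_trans hi' (Nat.le_add_left _ _))]
      simp
    · have h₁ : star (path R δ) * (z * path R γ) * path R δ = l (.inr γ) • vertex R b := by
        rw [hz_def, Finsupp.sum, Finset.sum_mul, Finset.mul_sum, Finset.sum_mul,
          Finset.sum_eq_single_of_mem _ hi]
        · simp only [mul_smul_comm, smul_mul_assoc, closedGenerator, Sum.elim_inr]
          rw [star_path_mul_path_self, star_path_mul_vertex, star_path_mul_path_self]
        · rintro (γ' | γ') hj hne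
          · simp only [mul_smul_comm, smul_mul_assoc, closedGenerator, Sum.elim_inl]
            have := hN _ hj
            change γ'.length ≤ N at this
            change γ.length ≤ N at hi'
            change 0 < γ.length at h0
            rw [← path_comp, hδ _ (by rw [Quiver.Path.length_comp]; omega)
              (by rw [Quiver.Path.length_comp]; omega), smul_zero]
          · simp only [mul_smul_comm, smul_mul_assoc, closedGenerator, Sum.elim_inr]
            rw [star_path_mul_star_mul_path_eq_zero hδ (fun h => hne (by rw [h])) (hN _ hj) hi',
              smul_zero]
      refine eq_zero_of_smul_vertex_eq_zero (h₁.symm.trans ?_)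
      rw [← mul_assoc, hδz, mul_assoc _ _ (path R γ), mul_assoc, mul_assoc (path R δ),
        mul_assoc (path R δ), hδ γ h0 (le_trans hi' (Nat.le_add_left _ _))]
      simp
  -- Only the trivial path and its adjoint can remain, and both equal the vertex.
  refine ⟨∑ i ∈ l.support, l i, ?_⟩
  rw [hz_def, Finsupp.sum, Finset.sum_smul]
  refine Finset.sum_congr rfl fun i hi => congrArg _ ?_
  rcases i with γ | γ
  · have : γ = .nil := γ.eq_nil_of_length_zero (hlen _ hi)
    rw [this]
    rfl
  · have : γ = .nil := γ.eq_nil_of_length_zero (hlen _ hi)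
    rw [this]
    exact star_vertex a

end Closed

/-! ### Cutting off finitely many edges; local units -/

section Cutoff

variable {R : Type t} [CommRing R] {V : Type u} [Quiver.{w} V]

/-- The vertex `a` minus the projections `e e*` for finitely many edges `e` with source `a`. -/
noncomputable def cutoff (R : Type t) [CommRing R] {V : Type u} [Quiver.{w} V] {a : V}
    (F : Finset (Quiver.Star a)) : LeavittPathAlgebra R V :=
  vertex R a - ∑ e ∈ F, edge R ⟨a, e.1, e.2⟩ * star (edge R ⟨a, e.1, e.2⟩)

theorem star_cutoff {a : V} (F : Finset (Quiver.Star a)) : star (cutoff R F) = cutoff R F := by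
  simp [cutoff, star_vertex]

theorem cutoff_mul_vertex {a : V} (F : Finset (Quiver.Star a)) :
    cutoff R F * vertex R a = cutoff R F := by
  rw [cutoff, sub_mul, vertex_mul_self, Finset.sum_mul]
  congr 1
  refine Finset.sum_congr rfl fun e _ => ?_
  rw [mul_assoc, ← star_vertex, ← star_mul, vertex_mul_edge ⟨a, e.1, e.2⟩]

theorem cutoff_mul_edge {a : V} {F : Finset (Quiver.Star a)} {e : Quiver.Star a} (he : e ∈ F) :
    cutoff R F * edge R ⟨a, e.1, e.2⟩ = 0 := by
  rw [cutoff, sub_mul, vertex_mul_edge ⟨a, e.1, e.2⟩, Finset.sum_mul,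
    Finset.sum_eq_single_of_mem e he, mul_assoc, star_edge_mul_edge, edge_mul_vertex ⟨a, e.1, e.2⟩, sub_self]
  intro f _ hfe
  rw [mul_assoc, star_edge_mul_edge_of_ne, mul_zero]
  rintro h
  apply hfe
  obtain ⟨b, e⟩ := e
  obtain ⟨b', f⟩ := f
  obtain ⟨-, rfl, h⟩ := Quiver.Total.mk.inj h
  obtain rfl := eq_of_heq h
  rfl

theorem cutoff_mul_self {a : V} (F : Finset (Quiver.Star a)) :
    cutoff R F * cutoff R F = cutoff R F := by
  nth_rw 2 [cutoff]
  rw [mul_sub, cutoff_mul_vertex, Finset.mul_sum, Finset.sum_eq_zero, sub_zero]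
  intro e he
  rw [← mul_assoc, cutoff_mul_edge he, zero_mul]

/-- It is enough to cut off the first edge of `α`. Allowing every larger `G` lets finitely many
conditions be met at once. -/
theorem exists_cutoff_mul_path_eq_zero (a : V) {b c : V} (α : Quiver.Path b c) (h : α.length ≠ 0) :
    ∃ F : Finset (Quiver.Star a), ∀ G, F ⊆ G → cutoff R G * path R α = 0 := by
  by_cases hab : a = b
  · subst hab
    obtain ⟨d, e, α', rfl, -⟩ := (Quiver.Path.length_ne_zero_iff_eq_comp α).1 h
    refine ⟨{⟨d, e⟩}, fun G hG => ?_⟩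
    rw [path_comp, path_toPath ⟨a, d, e⟩, ← mul_assoc,
      cutoff_mul_edge (e := ⟨d, e⟩) (Finset.singleton_subset_iff.1 hG), zero_mul]
  · refine ⟨∅, fun G _ => ?_⟩
    rw [← vertex_mul_path α, ← cutoff_mul_vertex G, mul_assoc, ← mul_assoc (vertex R a),
      vertex_mul_vertex_of_ne hab, zero_mul, mul_zero]

open Classical in
/-- Every element becomes scalar after cutting it off by sufficiently many edges. -/
theorem exists_cutoff_mul_mul_cutoff_eq_smul (a : V) (z : LeavittPathAlgebra R V) :
    ∃ (F : Finset (Quiver.Star a)) (c : R), ∀ G, F ⊆ G →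
      cutoff R G * z * cutoff R G = c • cutoff R G := by
  induction z using generators_induction with
  | gen b b' d α β =>
    by_cases hα : α.length = 0
    · by_cases hβ : β.length = 0
      · obtain rfl := α.eq_of_length_zero hα
        obtain rfl := β.eq_of_length_zero hβ
        obtain rfl := α.eq_nil_of_length_zero hα
        obtain rfl := β.eq_nil_of_length_zero hβ
        rw [path_nil, star_vertex, vertex_mul_self]
        by_cases hab : a = b'
        · subst hab
          exact ⟨∅, 1, fun G _ => by rw [cutoff_mul_vertex, cutoff_mul_self, one_smul]⟩
        · refine ⟨∅, 0, fun G _ => ?_⟩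
          rw [← cutoff_mul_vertex G, mul_assoc _ _ (vertex R b'), vertex_mul_vertex_of_ne hab]
          simp
      · obtain ⟨F, hF⟩ := exists_cutoff_mul_path_eq_zero (R := R) a β hβ
        refine ⟨F, 0, fun G hG => ?_⟩
        have h : star (path R β) * cutoff R G = 0 := by
          simpa [star_cutoff] using congrArg star (hF G hG)
        rw [mul_assoc, mul_assoc, h]
        simp
    · obtain ⟨F, hF⟩ := exists_cutoff_mul_path_eq_zero (R := R) a α hα
      refine ⟨F, 0, fun G hG => ?_⟩
      rw [← mul_assoc, hF G hG]
      simp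
  | zero => exact ⟨∅, 0, by simp⟩
  | add x y hx hy =>
    obtain ⟨F, c, hF⟩ := hx
    obtain ⟨F', c', hF'⟩ := hy
    refine ⟨F ∪ F', c + c', fun G hG => ?_⟩
    rw [mul_add, add_mul, hF G (Finset.union_subset_left hG), hF' G (Finset.union_subset_right hG),
      add_smul]
  | smul r x hx =>
    obtain ⟨F, c, hF⟩ := hx
    refine ⟨F, r * c, fun G hG => ?_⟩
    rw [mul_smul_comm, smul_mul_assoc, hF G hG, mul_smul]

-- Finite sums of vertices are local units, so membership of `x` in the core can be tested on the
-- elements `x v`.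
open Classical in
theorem exists_mul_sum_vertex_eq (x : LeavittPathAlgebra R V) :
    ∃ U : Finset V, ∀ W, U ⊆ W → x * ∑ v ∈ W, vertex R v = x := by
  induction x using generators_induction with
  | gen a b c α β =>
    refine ⟨{b}, fun W hW => ?_⟩
    rw [mul_assoc, Finset.mul_sum, Finset.sum_eq_single_of_mem b (Finset.singleton_subset_iff.1 hW),
      star_path_mul_vertex]
    intro v _ hv
    rw [← star_path_mul_vertex, mul_assoc, vertex_mul_vertex_of_ne hv.symm, mul_zero]
  | zero => exact ⟨∅, by simp⟩
  | add x y hx hy =>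
    obtain ⟨F, hF⟩ := hx
    obtain ⟨F', hF'⟩ := hy
    refine ⟨F ∪ F', fun G hG => ?_⟩
    rw [add_mul, hF G (Finset.union_subset_left hG), hF' G (Finset.union_subset_right hG)]
  | smul r x hx =>
    obtain ⟨F, hF⟩ := hx
    exact ⟨F, fun G hG => by rw [smul_mul_assoc, hF G hG]⟩

theorem exists_mem_span_length_le (x : LeavittPathAlgebra R V) :
    ∃ N : ℕ, x ∈ Submodule.span R {y | ∃ (a b c : V) (α : Quiver.Path a c) (β : Quiver.Path b c),
      β.length ≤ N ∧ y = path R α * star (path R β)} := by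
  have mono {m n : ℕ} (h : m ≤ n) : Submodule.span R {y : LeavittPathAlgebra R V |
      ∃ (a b c : V) (α : Quiver.Path a c) (β : Quiver.Path b c),
        β.length ≤ m ∧ y = path R α * star (path R β)} ≤ Submodule.span R {y |
      ∃ (a b c : V) (α : Quiver.Path a c) (β : Quiver.Path b c),
        β.length ≤ n ∧ y = path R α * star (path R β)} := by
    refine Submodule.span_mono ?_
    rintro _ ⟨a, b, c, α, β, hβ, rfl⟩
    exact ⟨a, b, c, α, β, hβ.trans h, rfl⟩
  induction x using generators_induction with
  | gen a b c α β => exact ⟨β.length, Submodule.subset_span ⟨a, b, c, α, β, le_rfl, rfl⟩⟩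
  | zero => exact ⟨0, zero_mem _⟩
  | add x y hx hy =>
    obtain ⟨m, hm⟩ := hx
    obtain ⟨n, hn⟩ := hy
    exact ⟨max m n, add_mem (mono (le_max_left _ _) hm) (mono (le_max_right _ _) hn)⟩
  | smul r x hx =>
    obtain ⟨m, hm⟩ := hx
    exact ⟨m, Submodule.smul_mem _ _ hm⟩

end Cutoff

/-! ### The core and the commutant of the diagonal -/

section Core

variable {R : Type t} [CommRing R] {V : Type u} [Quiver.{w} V]

theorem star_mem_generators {x : LeavittPathAlgebra R V} (hx : x ∈ generators R V) :
    star x ∈ generators R V := by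
  obtain ⟨a, b, c, α, β, rfl⟩ := hx
  rw [star_mul, star_star]
  exact path_mul_star_path_mem_generators β α

theorem star_mem_commutativeCore {x : LeavittPathAlgebra R V} (hx : x ∈ commutativeCore R V) :
    star x ∈ commutativeCore R V := by
  induction hx using NonUnitalAlgebra.adjoin_induction with
  | mem x hx =>
    have := hx.2
    exact NonUnitalAlgebra.subset_adjoin R ⟨star_mem_generators hx.1, inferInstance⟩
  | zero => rw [star_zero]; exact zero_mem _
  | add x y _ _ hx hy => rw [star_add]; exact add_mem hx hy
  | mul x y _ _ hx hy => rw [star_mul]; exact mul_mem hy hx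
  | smul r x _ hx => rw [star_smul']; exact SMulMemClass.smul_mem r hx

theorem conj_path_mem_commutativeCore {a b : V} {η : Quiver.Path a a}
    (h : path R η * star (path R η) = vertex R a) (β : Quiver.Path b a) :
    path R β * path R η * star (path R β) ∈ commutativeCore R V := by
  refine NonUnitalAlgebra.subset_adjoin R ⟨⟨b, b, a, β.comp η, β, by rw [path_comp]⟩, ⟨?_⟩⟩
  have h₁ (x) : star (path R β) * (path R β * x) = vertex R a * x := by
    rw [← mul_assoc, star_path_mul_path_self]
  have h₂ (x) : star (path R η) * (path R η * x) = vertex R a * x := by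
    rw [← mul_assoc, star_path_mul_path_self]
  have h₃ (x) : path R η * (star (path R η) * x) = vertex R a * x := by
    rw [← mul_assoc, h]
  have h₄ (x) : vertex R a * (path R η * x) = path R η * x := by
    rw [← mul_assoc, vertex_mul_path]
  have h₅ (x) : vertex R a * (star (path R η) * x) = star (path R η) * x := by
    rw [← mul_assoc, vertex_mul_star_path]
  rw [Commute, SemiconjBy]
  simp only [star_mul, star_star, mul_assoc, h₁, h₂, h₃, h₄, h₅]

theorem path_mul_star_path_mem_commutativeCore {a b : V} (β : Quiver.Path b a) :
    path R β * star (path R β) ∈ commutativeCore R V := by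
  have := conj_path_mem_commutativeCore (R := R) (η := .nil)
    (by rw [path_nil, star_vertex, vertex_mul_self]) β
  rwa [path_nil, path_mul_vertex] at this

theorem diagonal_le_commutativeCore : diagonal R V ≤ commutativeCore R V := by
  refine NonUnitalAlgebra.adjoin_le ?_
  rintro _ ⟨b, a, β, rfl⟩
  exact path_mul_star_path_mem_commutativeCore β

/-- Without exits at `a` each term of `z` gives a normal generator or its adjoint; with an exit `z`
is a multiple of `a`. -/
theorem conj_mem_commutativeCore [Nontrivial R] {a b : V} (β : Quiver.Path b a)
    {z : LeavittPathAlgebra R V}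
    (hz : z ∈ Submodule.span R (Set.range (closedGenerator R a)))
    (hcomm : ∀ (b : V) (δ : Quiver.Path a b),
      z * (path R δ * star (path R δ)) = path R δ * star (path R δ) * z) :
    path R β * z * star (path R β) ∈ commutativeCore R V := by
  by_cases h : ∀ η : Quiver.Path a a, path R η * star (path R η) = vertex R a
  · clear hcomm
    induction hz using Submodule.span_induction with
    | mem z hz =>
      obtain ⟨γ | γ, rfl⟩ := hz
      · exact conj_path_mem_commutativeCore (h γ) β
      · simpa [closedGenerator, mul_assoc] using
          star_mem_commutativeCore (conj_path_mem_commutativeCore (h γ) β)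
    | zero => rw [mul_zero, zero_mul]; exact zero_mem _
    | add x y _ _ hx hy => rw [mul_add, add_mul]; exact add_mem hx hy
    | smul r x _ hx => rw [mul_smul_comm, smul_mul_assoc]; exact SMulMemClass.smul_mem r hx
  · push Not at h
    obtain ⟨μ, hμ⟩ := h
    obtain ⟨c, rfl⟩ := exists_eq_smul_vertex hμ hz hcomm
    rw [mul_smul_comm, smul_mul_assoc, path_mul_vertex]
    exact SMulMemClass.smul_mem c (path_mul_star_path_mem_commutativeCore β)

/-- Compress by `β` the relation saying that `x` commutes with the projection of `β δ`. -/
theorem conj_commute {x : LeavittPathAlgebra R V}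
    (hx : ∀ (a b : V) (δ : Quiver.Path a b), x * (path R δ * star (path R δ)) =
      path R δ * star (path R δ) * x)
    {a b c : V} (β : Quiver.Path b a) (δ : Quiver.Path a c) :
    star (path R β) * x * path R β * (path R δ * star (path R δ)) =
      path R δ * star (path R δ) * (star (path R β) * x * path R β) := by
  have h := hx _ _ (β.comp δ)
  rw [path_comp, star_mul] at h
  have h₁ (y) : star (path R β) * (path R β * y) = vertex R a * y := by
    rw [← mul_assoc, star_path_mul_path_self]
  have h₂ (y) : vertex R a * (path R δ * y) = path R δ * y := by
    rw [← mul_assoc, vertex_mul_path]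
  have h₃ := congrArg (fun y => star (path R β) * y * path R β) h
  simp only [mul_assoc, h₁, h₂, star_path_mul_path_self, star_path_mul_vertex] at h₃ ⊢
  exact h₃

/-- Induction on `n`, which bounds how far `β` falls short of length `N`. -/
theorem mul_path_mul_star_path_mem_commutativeCore [Nontrivial R] {x : LeavittPathAlgebra R V}
    (hx : ∀ (a b : V) (δ : Quiver.Path a b), x * (path R δ * star (path R δ)) =
      path R δ * star (path R δ) * x) {N : ℕ}
    (hN : x ∈ Submodule.span R {y | ∃ (a b c : V) (α : Quiver.Path a c) (β : Quiver.Path b c),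
      β.length ≤ N ∧ y = path R α * star (path R β)}) (n : ℕ)
    {a b : V} (β : Quiver.Path b a) (hβ : N ≤ β.length + n) :
    x * (path R β * star (path R β)) ∈ commutativeCore R V := by
  induction n generalizing a b with
  | zero =>
    have h := conj_mem_commutativeCore β (star_path_mul_span_mul_path_mem hN β hβ)
      fun _ δ => conj_commute hx β δ
    have h' : path R β * (star (path R β) * x * path R β) * star (path R β) =
        path R β * star (path R β) * x * (path R β * star (path R β)) := by
      simp only [mul_assoc]
    rwa [h', ← hx, mul_assoc, ← mul_assoc (path R β * _), path_mul_star_path_mul_path] at h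
  | succ n ih =>
    obtain ⟨F, c, hF⟩ := exists_cutoff_mul_mul_cutoff_eq_smul a (star (path R β) * x * path R β)
    have hF := hF F subset_rfl
    -- The projection `g` is what remains of `β β*` after removing the extensions of `β` by edges in
    -- `F`. It commutes with `x`, so `x g = g x g`, and this is `c • g` by the choice of `F`.
    let g := path R β * cutoff R F * star (path R β)
    have hg : path R β * star (path R β) =
        ∑ e ∈ F, path R (β.cons e.2) * star (path R (β.cons e.2)) + g := by
      simp only [g, cutoff, mul_sub, sub_mul, vertex_mul_star_path, Finset.mul_sum, Finset.sum_mul,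
        path_cons, star_mul, mul_assoc]
      abel
    have hxg : x * g = g * x := by
      rw [eq_sub_of_add_eq' hg.symm, mul_sub, sub_mul, hx, Finset.mul_sum, Finset.sum_mul]
      congr 1
      exact Finset.sum_congr rfl fun e _ => hx _ _ _
    have hcv : cutoff R F * (star (path R β) * path R β) * cutoff R F = cutoff R F := by
      rw [star_path_mul_path_self, cutoff_mul_vertex, cutoff_mul_self]
    have hgg : g * g = g := by
      calc g * g = path R β * (cutoff R F * (star (path R β) * path R β) * cutoff R F) *
            star (path R β) := by simp only [g, mul_assoc]
        _ = g := by rw [hcv]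
    have hgM : g ∈ commutativeCore R V := by
      rw [eq_sub_of_add_eq' hg.symm]
      exact sub_mem (path_mul_star_path_mem_commutativeCore _)
        (sum_mem fun e _ => path_mul_star_path_mem_commutativeCore _)
    have hxgM : x * g = c • g := by
      calc x * g = g * x * g := by rw [← hxg, mul_assoc, hgg]
        _ = path R β * (cutoff R F * (star (path R β) * x * path R β) * cutoff R F) *
            star (path R β) := by simp only [g, mul_assoc]
        _ = c • g := by rw [hF, mul_smul_comm, smul_mul_assoc]
    rw [hg, mul_add, hxgM, Finset.mul_sum]
    refine add_mem (sum_mem fun e _ => ih _ ?_) (SMulMemClass.smul_mem c hgM)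
    rw [Quiver.Path.length_cons]
    omega

theorem mem_commutativeCore_of_commute [Nontrivial R] {x : LeavittPathAlgebra R V}
    (hx : ∀ d ∈ diagonal R V, x * d = d * x) : x ∈ commutativeCore R V := by
  have hx' (a b : V) (δ : Quiver.Path a b) : x * (path R δ * star (path R δ)) =
      path R δ * star (path R δ) * x :=
    hx _ (NonUnitalAlgebra.subset_adjoin R ⟨a, b, δ, rfl⟩)
  obtain ⟨N, hN⟩ := exists_mem_span_length_le x
  obtain ⟨U, hU⟩ := exists_mul_sum_vertex_eq x
  rw [← hU U subset_rfl, Finset.mul_sum]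
  refine sum_mem fun v _ => ?_
  have := mul_path_mul_star_path_mem_commutativeCore hx' hN N (.nil : Quiver.Path v v)
    (Nat.le_add_left _ _)
  rwa [path_nil, star_vertex, vertex_mul_self] at this

theorem commute_of_isStarNormal [Nontrivial R] {x y : LeavittPathAlgebra R V}
    (hx : x ∈ generators R V) (hxn : IsStarNormal x) (hy : y ∈ generators R V)
    (hyn : IsStarNormal y) : Commute x y := by
  -- With `y = β η β*` and `p = β β*`, the adjoint of `y` is its inverse in the corner at `p`; so
  -- whatever commutes with `y` and `p` commutes with `star y`.
  have adj {x : LeavittPathAlgebra R V} {a b : V} {β : Quiver.Path b a} {η : Quiver.Path a a}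
      (hη : path R η * star (path R η) = vertex R a)
      (hp : Commute x (path R β * star (path R β)))
      (hc : Commute x (path R β * path R η * star (path R β))) :
      Commute x (star (path R β * path R η * star (path R β))) := by
    set y := path R β * path R η * star (path R β) with hy
    set p := path R β * star (path R β) with hp_def
    have hy' : star y = path R β * star (path R η) * star (path R β) := by
      rw [hy, star_mul, star_mul, star_star, mul_assoc]
    have hβ (z) : star (path R β) * (path R β * z) = vertex R a * z := by
      rw [← mul_assoc, star_path_mul_path_self]
    have hη' (z) : path R η * (star (path R η) * z) = vertex R a * z := by rw [← mul_assoc, hη]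
    have hη'' (z) : star (path R η) * (path R η * z) = vertex R a * z := by
      rw [← mul_assoc, star_path_mul_path_self]
    have hv (z) : vertex R a * (path R η * z) = path R η * z := by
      rw [← mul_assoc, vertex_mul_path]
    have hv' (z) : vertex R a * (star (path R η) * z) = star (path R η) * z := by
      rw [← mul_assoc, vertex_mul_star_path]
    have h₁ : y * star y = p := by
      rw [hy', hy, hp_def]
      simp only [mul_assoc, hβ, hη', hv', vertex_mul_star_path]
    have h₂ : star y * y = p := by
      rw [hy', hy, hp_def]
      simp only [mul_assoc, hβ, hη'', hv, vertex_mul_star_path]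
    have h₃ : p * star y = star y := by
      rw [hy', hp_def, ← mul_assoc, ← mul_assoc, path_mul_star_path_mul_path]
    have h₄ : star y * p = star y := by
      rw [hy', hp_def, mul_assoc, star_path_mul_path_mul_star_path]
    calc x * star y = x * (p * star y) := by rw [h₃]
      _ = star y * (y * x) * star y := by rw [← mul_assoc, hp.eq, ← h₂]; simp only [mul_assoc]
      _ = star y * x * (y * star y) := by rw [← hc.eq]; simp only [mul_assoc]
      _ = star y * x := by rw [h₁, mul_assoc, hp.eq, ← mul_assoc, h₄]
  obtain ⟨a, b, β, η, hη, h⟩ := exists_conj_path_of_isStarNormal hx hxn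
  obtain ⟨c, d, δ, θ, hθ, h'⟩ := exists_conj_path_of_isStarNormal hy hyn
  have h₁ := conj_path_commute hη hθ β δ
  have h₂ := adj hθ (conj_path_commute_diagonal hη β δ) h₁
  rcases h with h | h <;> rcases h' with h' | h'
  · rw [h, h']
    exact h₁
  · rw [← h, ← h', star_star] at h₂
    exact h₂
  · have := h₂.star_star
    rw [← h, ← h', star_star, star_star] at this
    exact this
  · have : Commute (star x) (star y) := by
      rw [h, h']
      exact h₁
    simpa using this.star_star

theorem commute_of_mem_commutativeCore [Nontrivial R] {x y : LeavittPathAlgebra R V}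
    (hx : x ∈ commutativeCore R V) (hy : y ∈ commutativeCore R V) : Commute x y := by
  refine NonUnitalAlgebra.commute_of_mem_adjoin_of_forall_mem_commute hy fun y hy => ?_
  refine (NonUnitalAlgebra.commute_of_mem_adjoin_of_forall_mem_commute hx fun x hx => ?_).symm
  exact commute_of_isStarNormal hy.1 hy.2 hx.1 hx.2

end Core

end LeavittPathAlgebra

/-- The commutative core `M_R(E)` is the commutant in `L_R(E)` of the diagonal `Δ(E)`; it is closed
under the involution, it is commutative, and no commutative subalgebra of `L_R(E)` (closed under
the involution or not) is strictly larger. -/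
theorem theorem3 (R : Type t) [CommRing R] (V : Type u) [Quiver.{w} V] :
    (LeavittPathAlgebra.commutativeCore R V : Set (LeavittPathAlgebra R V)) =
        {x | ∀ d ∈ LeavittPathAlgebra.diagonal R V, x * d = d * x} ∧
      (∀ x ∈ LeavittPathAlgebra.commutativeCore R V,
        star x ∈ LeavittPathAlgebra.commutativeCore R V) ∧
      (∀ x ∈ LeavittPathAlgebra.commutativeCore R V,
        ∀ y ∈ LeavittPathAlgebra.commutativeCore R V, x * y = y * x) ∧
      (∀ C : NonUnitalSubalgebra R (LeavittPathAlgebra R V),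
        (∀ x ∈ C, ∀ y ∈ C, x * y = y * x) →
          LeavittPathAlgebra.commutativeCore R V ≤ C →
            C = LeavittPathAlgebra.commutativeCore R V) := by
  open LeavittPathAlgebra in
  -- Over the zero ring the algebra is zero; nonvanishing of paths requires `R` nontrivial.
  rcases subsingleton_or_nontrivial R with hR | hR
  · have : Subsingleton (LeavittPathAlgebra R V) := Module.subsingleton R _
    have h (S T : Set (LeavittPathAlgebra R V)) (hS : 0 ∈ S) (hT : 0 ∈ T) : S = T := by
      ext x
      rw [Subsingleton.elim x 0]
      exact iff_of_true hS hT
    exact ⟨h _ _ (zero_mem (commutativeCore R V)) fun _ _ => Subsingleton.elim _ _,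
      fun _ hx => star_mem_commutativeCore hx, fun _ _ _ _ => Subsingleton.elim _ _,
      fun C _ _ => SetLike.coe_injective (h _ _ (zero_mem C) (zero_mem (commutativeCore R V)))⟩
  · refine ⟨Set.Subset.antisymm (fun x hx d hd => ?_) fun x hx => mem_commutativeCore_of_commute hx,
      fun _ hx => star_mem_commutativeCore hx,
      fun x hx y hy => commute_of_mem_commutativeCore hx hy, fun C hC hle => ?_⟩
    · exact commute_of_mem_commutativeCore hx (diagonal_le_commutativeCore hd)
    · refine le_antisymm (fun x hx => mem_commutativeCore_of_commute fun d hd => ?_) hle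
      exact hC x hx d (hle (diagonal_le_commutativeCore hd))
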